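/- **Conventions.** $\mathbf{Hilb}$ is the symmetric monoidal category of complex Hilbert spaces and bounded linear maps, with the Hilbertian tensor product $\otimes_2$ (the completion of the algebraic tensor product) and its unitary associativity constraint $a$ and symmetry. $\mathbf{FdHilb}$ is its full subcategory of finite-dimensional spaces. A *commutative Hilbertian Frobenius semigroup* is a pair $(H,\mu)$ where $H$ is a Hilbert space and $\mu\colon H\otimes_2 H\to H$ is a bounded linear map that is associative and commutative and satisfies the Frobenius condition $$\mu^\dagger\mu=(\mu\otimes_2 \mathrm{id})\,a^{-1}\,(\mathrm{id}\otimes_2\mu^\dagger)=(\mathrm{id}\otimes_2\mu)\,a\,(\mu^\dagger\otimes_2\mathrm{id}).$$ A morphism $f\colon(H,\mu)\to(K,\gamma)$ is a bounded linear map with $f\mu=\gamma(f\otimes_2 f)$. This is the category ${}_c\mathbf{FrobSem}(\mathbf{Hilb})$. Write $xy=\mu(x\otimes y)$. The *Jacobson radical* $J(H,\mu)$ is the intersection of the maximal modular ideals (and is $H$ if there are none); a modular ideal is an ideal $I$ with some $e\in H$ such that $x-ex\in I$ for all $x$, and it is maximal if it is maximal among the proper ideals. $(H,\mu)$ is *semisimple*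 if $J(H,\mu)=0$; ${}_{\mathsf{semisimple},c}\mathbf{FrobSem}(\mathbf{Hilb})$ is the full subcategory of the semisimple ones, and ${}_{\mathsf{semisimple},c}\mathbf{FrobSem}(\mathbf{FdHilb})$ that of the finite-dimensional semisimple ones. An element $g\neq0$ is *group-like* if $\mu^\dagger(g)=g\otimes g$. A *weighted pointed set* is a triple $(X,x_0,\alpha)$ with $x_0\in X$ and $\alpha\colon X\setminus\{x_0\}\to[C,+\infty[$ for some real $C>0$. A morphism $(X,x_0,\alpha)\to(Y,y_0,\beta)$ is a map $f\colon X\to Y$ with $f(x_0)=y_0$, such that $f^{-1}(\{y\})$ is finite for every $y\neq y_0$, and such that for some $M\ge0$ one has $\sum_{x\in f^{-1}(\{y\})}\alpha(x)\le M\beta(y)$ for all $y\ne y_0$. This is the category $\mathbf{WSet}_\bullet$. $\mathbf{FinSet}_\bullet$ is the category of finite pointed sets and base-point preserving maps. **The functor $\ell^2_\bullet\colon\mathbf{WSet}_\bullet^{\mathsf{op}}\to{}_c\mathbf{FrobSem}(\mathbf{Hilb})$.** $\ell^2_\bullet(X,x_0,\alpha)$ is the Hilbert space of the functions $u\colon X\to\mathbb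 C$ with $u(x_0)=0$ and $\sum_{x\neq x_0}\alpha(x)|u(x)|^2<\infty$, with the inner product weighted by $\alpha$ and the pointwise product; $\ell^2_\bullet(f)(u)=u\circ f$. Its values are semisimple. **The functor $\mathrm{Min}_\bullet\colon{}_c\mathbf{FrobSem}(\mathbf{Hilb})\to\mathbf{WSet}_\bullet^{\mathsf{op}}$.** Let $\mathrm{Min}(H,\mu)$ be the set of the minimal (non-zero) ideals contained in $J(H,\mu)^\perp$ (all the minimal ideals if $(H,\mu)$ is semisimple). Each $I\in\mathrm{Min}(H,\mu)$ is $\mathbb Cg_I$ for a unique group-like element $g_I$; put $g_0=0$. Then $\mathrm{Min}_\bullet(H,\mu)=(\mathrm{Min}(H,\mu)\cup\{0\},\,0,\,I\mapsto\|g_I\|^{-2})$, and a morphism $f\colon(H,\mu)\to(K,\gamma)$ is sent to the map $\mathrm{Min}(K,\gamma)\cup\{0\}\to \mathrm{Min}(H,\mu)\cup\{0\}$, $J\mapsto\mathbb C f^\dagger(g_J)$. **Theorem.** There is an adjunction $$\mathrm{Min}_\bullet\dashv\ell^2_\bullet\colon\mathbf{WSet}_\bullet^{\mathsf{op}}\to{}_c\mathbf{FrobSem}(\mathbf{Hilb}),$$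 and it restricts (with the same unit and counit) to an adjoint equivalence $$\mathrm{Min}_\bullet\dashv\ell^2_\bullet\colon\mathbf{WSet}_\bullet^{\mathsf{op}}\simeq{}_{\mathsf{semisimple},c}\mathbf{FrobSem}(\mathbf{Hilb}).$$ In particular ${}_{\mathsf{semisimple},c}\mathbf{FrobSem}(\mathbf{FdHilb})\simeq\mathbf{FinSet}_\bullet^{\mathsf{op}}$, by an equivalence that sends $(H,\mu)$ to the pointed set $(\mathrm{Min}(H,\mu)\cup\{0\},0)$ and is $J\mapsto\mathbb Cf^\dagger(g_J)$ on morphisms, up to natural isomorphism. -/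

import Mathlib

open scoped TensorProduct
open CategoryTheory

universe u

namespace HilbFrob

noncomputable section

section HilbertTensor

/-- The Hilbertian tensor product: the completion of the algebraic tensor product for the inner
product `⟪x ⊗ y, x' ⊗ y'⟫ = ⟪x, x'⟫ * ⟪y, y'⟫`. -/
abbrev HTensor (H K : Type*) [NormedAddCommGroup H] [InnerProductSpace ℂ H]
    [NormedAddCommGroup K] [InnerProductSpace ℂ K] : Type _ :=
  UniformSpace.Completion (H ⊗[ℂ] K)

variable {H K L H' K' : Type*}
  [NormedAddCommGroup H] [InnerProductSpace ℂ H]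
  [NormedAddCommGroup K] [InnerProductSpace ℂ K]
  [NormedAddCommGroup L] [InnerProductSpace ℂ L]
  [NormedAddCommGroup H'] [InnerProductSpace ℂ H']
  [NormedAddCommGroup K'] [InnerProductSpace ℂ K']

/-- The elementary tensor `x ⊗ y` in the Hilbertian tensor product. -/
def htmul (x : H) (y : K) : HTensor H K := ((x ⊗ₜ[ℂ] y : H ⊗[ℂ] K) : HTensor H K)

/-- The elementary tensors, as a bounded bilinear map. -/
def htmulL : H →L[ℂ] K →L[ℂ] HTensor H K :=
  (ContinuousLinearMap.compL ℂ K (H ⊗[ℂ] K) (HTensor H K) UniformSpace.Completion.toComplL) ∘L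
    TensorProduct.mkL ℂ H K

theorem htmulL_apply (x : H) (y : K) : htmulL x y = htmul x y := rfl

theorem htmul_add (x : H) (y y' : K) : htmul x (y + y') = htmul x y + htmul x y' := by
  simp [← htmulL_apply]

theorem htmul_smul (c : ℂ) (x : H) (y : K) : htmul x (c • y) = c • htmul x y := by
  simp [← htmulL_apply]

theorem smul_htmul (c : ℂ) (x : H) (y : K) : htmul (c • x) y = c • htmul x y := by
  simp [← htmulL_apply]

theorem inner_htmul (x x' : H) (y y' : K) :
    inner ℂ (htmul x y) (htmul x' y') = inner ℂ x x' * inner ℂ y y' := by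
  simp [htmul]

theorem norm_htmul (x : H) (y : K) : ‖htmul x y‖ = ‖x‖ * ‖y‖ := by
  simp [htmul]

/-- A closed subspace that contains the elementary tensors is everything. -/
theorem htensor_mem (S : Submodule ℂ (HTensor H K)) (hc : IsClosed (S : Set (HTensor H K)))
    (ht : ∀ x y, htmul x y ∈ S) (t : HTensor H K) : t ∈ S := by
  induction t using UniformSpace.Completion.induction_on with
  | hp => exact hc
  | ih t =>
    induction t using TensorProduct.induction_on with
    | zero => rw [UniformSpace.Completion.coe_zero]; exact S.zero_mem
    | tmul x y => exact ht x y
    | add s t hs ht' => rw [UniformSpace.Completion.coe_add]; exact S.add_mem hs ht'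

theorem htensor_ext {E : Type*} [NormedAddCommGroup E] [NormedSpace ℂ E]
    {f g : HTensor H K →L[ℂ] E} (h : ∀ x y, f (htmul x y) = g (htmul x y)) : f = g := by
  ext t
  exact htensor_mem (LinearMap.eqLocus (f : HTensor H K →ₗ[ℂ] E) g)
    (isClosed_eq f.continuous g.continuous) h t

theorem htensor_ext_inner {s t : HTensor H K}
    (h : ∀ x y, inner ℂ s (htmul x y) = inner ℂ t (htmul x y)) : s = t := by
  refine ext_inner_right ℂ fun v => ?_
  have : innerSL ℂ s = innerSL ℂ t := htensor_ext h
  exact congrArg (fun φ => φ v) this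

/-- The Hilbertian tensor product of two bounded linear maps. -/
def hmap (f : H →L[ℂ] H') (g : K →L[ℂ] K') : HTensor H K →L[ℂ] HTensor H' K' :=
  (TensorProduct.mapL f g).completion

@[simp] theorem hmap_htmul (f : H →L[ℂ] H') (g : K →L[ℂ] K') (x : H) (y : K) :
    hmap f g (htmul x y) = htmul (f x) (g y) := by
  simp [hmap, htmul]

/-- The unitary symmetry constraint `x ⊗ y ↦ y ⊗ x`. -/
def hcomm (H K : Type*) [NormedAddCommGroup H] [InnerProductSpace ℂ H]
    [NormedAddCommGroup K] [InnerProductSpace ℂ K] : HTensor H K ≃ₗᵢ[ℂ] HTensor K H :=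
  (TensorProduct.commIsometry ℂ H K).toLinearEquiv.extendOfIsometry
    (UniformSpace.Completion.toComplₗᵢ (𝕜 := ℂ) (E := H ⊗[ℂ] K)).toLinearMap
    (UniformSpace.Completion.toComplₗᵢ (𝕜 := ℂ) (E := K ⊗[ℂ] H)).toLinearMap
    UniformSpace.Completion.denseRange_coe UniformSpace.Completion.denseRange_coe
    (by intro x; simp)

@[simp] theorem hcomm_htmul (x : H) (y : K) : hcomm H K (htmul x y) = htmul y x :=
  LinearEquiv.extendOfIsometry_eq (TensorProduct.commIsometry ℂ H K).toLinearEquiv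
    (UniformSpace.Completion.toComplₗᵢ (𝕜 := ℂ) (E := H ⊗[ℂ] K)).toLinearMap
    (UniformSpace.Completion.toComplₗᵢ (𝕜 := ℂ) (E := K ⊗[ℂ] H)).toLinearMap
    UniformSpace.Completion.denseRange_coe UniformSpace.Completion.denseRange_coe
    (by intro x; simp) (x ⊗ₜ y)

/-- The isometric inclusion of `(H ⊗ K) ⊗ L` in `(H ⊗₂ K) ⊗₂ L`. -/
def leftIncl (H K L : Type*) [NormedAddCommGroup H] [InnerProductSpace ℂ H]
    [NormedAddCommGroup K] [InnerProductSpace ℂ K] [NormedAddCommGroup L] [InnerProductSpace ℂ L] :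
    (H ⊗[ℂ] K) ⊗[ℂ] L →ₗᵢ[ℂ] HTensor (HTensor H K) L :=
  UniformSpace.Completion.toComplₗᵢ.comp
    (TensorProduct.mapIsometry UniformSpace.Completion.toComplₗᵢ LinearIsometry.id)

/-- The isometric inclusion of `H ⊗ (K ⊗ L)` in `H ⊗₂ (K ⊗₂ L)`. -/
def rightIncl (H K L : Type*) [NormedAddCommGroup H] [InnerProductSpace ℂ H]
    [NormedAddCommGroup K] [InnerProductSpace ℂ K] [NormedAddCommGroup L] [InnerProductSpace ℂ L] :
    H ⊗[ℂ] (K ⊗[ℂ] L) →ₗᵢ[ℂ] HTensor H (HTensor K L) :=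
  UniformSpace.Completion.toComplₗᵢ.comp
    (TensorProduct.mapIsometry LinearIsometry.id UniformSpace.Completion.toComplₗᵢ)

theorem leftIncl_tmul (x : H) (y : K) (z : L) :
    leftIncl H K L ((x ⊗ₜ y) ⊗ₜ z) = htmul (htmul x y) z := rfl

theorem rightIncl_tmul (x : H) (y : K) (z : L) :
    rightIncl H K L (x ⊗ₜ (y ⊗ₜ z)) = htmul x (htmul y z) := rfl

theorem denseRange_leftIncl : DenseRange (leftIncl H K L) := by
  intro t
  let S := (LinearMap.range (leftIncl H K L).toLinearMap).topologicalClosure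
  have hS : IsClosed (S : Set (HTensor (HTensor H K) L)) :=
    Submodule.isClosed_topologicalClosure _
  suffices h : t ∈ S by
    rwa [← SetLike.mem_coe, Submodule.topologicalClosure_coe] at h
  refine htensor_mem S hS (fun s z => ?_) t
  refine htensor_mem (S.comap (htmulL.flip z : HTensor H K →L[ℂ] _).toLinearMap)
    (hS.preimage (htmulL.flip z : HTensor H K →L[ℂ] _).continuous) (fun x y => ?_) s
  exact Submodule.le_topologicalClosure _ ⟨(x ⊗ₜ y) ⊗ₜ z, rfl⟩

theorem denseRange_rightIncl : DenseRange (rightIncl H K L) := by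
  intro t
  let S := (LinearMap.range (rightIncl H K L).toLinearMap).topologicalClosure
  have hS : IsClosed (S : Set (HTensor H (HTensor K L))) :=
    Submodule.isClosed_topologicalClosure _
  suffices h : t ∈ S by
    rwa [← SetLike.mem_coe, Submodule.topologicalClosure_coe] at h
  refine htensor_mem S hS (fun x s => ?_) t
  refine htensor_mem (S.comap (htmulL x : HTensor K L →L[ℂ] _).toLinearMap)
    (hS.preimage (htmulL x : HTensor K L →L[ℂ] _).continuous) (fun y z => ?_) s
  exact Submodule.le_topologicalClosure _ ⟨x ⊗ₜ (y ⊗ₜ z), rfl⟩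

/-- The unitary associativity constraint `(x ⊗ y) ⊗ z ↦ x ⊗ (y ⊗ z)`. -/
def hassoc (H K L : Type*) [NormedAddCommGroup H] [InnerProductSpace ℂ H]
    [NormedAddCommGroup K] [InnerProductSpace ℂ K] [NormedAddCommGroup L] [InnerProductSpace ℂ L] :
    HTensor (HTensor H K) L ≃ₗᵢ[ℂ] HTensor H (HTensor K L) :=
  (TensorProduct.assocIsometry ℂ H K L).toLinearEquiv.extendOfIsometry
    (leftIncl H K L).toLinearMap (rightIncl H K L).toLinearMap
    denseRange_leftIncl denseRange_rightIncl
    (by intro x; simp)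

@[simp] theorem hassoc_htmul (x : H) (y : K) (z : L) :
    hassoc H K L (htmul (htmul x y) z) = htmul x (htmul y z) :=
  LinearEquiv.extendOfIsometry_eq (TensorProduct.assocIsometry ℂ H K L).toLinearEquiv
    (leftIncl H K L).toLinearMap (rightIncl H K L).toLinearMap
    denseRange_leftIncl denseRange_rightIncl _ ((x ⊗ₜ y) ⊗ₜ z)

@[simp] theorem hassoc_symm_htmul (x : H) (y : K) (z : L) :
    (hassoc H K L).symm (htmul x (htmul y z)) = htmul (htmul x y) z := by
  rw [← hassoc_htmul, LinearIsometryEquiv.symm_apply_apply]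

/-- Two bounded maps on `(H ⊗₂ K) ⊗₂ L` that agree on elementary tensors are equal. -/
theorem htensor_ext₃ {E : Type*} [NormedAddCommGroup E] [NormedSpace ℂ E]
    {f g : HTensor (HTensor H K) L →L[ℂ] E}
    (h : ∀ x y z, f (htmul (htmul x y) z) = g (htmul (htmul x y) z)) : f = g := by
  refine htensor_ext fun s z => ?_
  have : f ∘L (htmulL.flip z) = g ∘L (htmulL.flip z) := htensor_ext fun x y => h x y z
  exact congrArg (fun φ => φ s) this

end HilbertTensor

/-! ### Commutative Hilbertian algebras -/

/-- A commutative semigroup object in the symmetric monoidal category of complex Hilbert spaces. -/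
structure HilbAlg : Type (u + 1) where
  carrier : Type u
  [normed : NormedAddCommGroup carrier]
  [ips : InnerProductSpace ℂ carrier]
  [complete : CompleteSpace carrier]
  /-- the multiplication -/
  mul : HTensor carrier carrier →L[ℂ] carrier
  assoc : mul ∘L hmap mul (ContinuousLinearMap.id ℂ carrier) =
    mul ∘L hmap (ContinuousLinearMap.id ℂ carrier) mul ∘L
      (hassoc carrier carrier carrier : _ →L[ℂ] _)
  comm : mul ∘L (hcomm carrier carrier : _ →L[ℂ] _) = mul

namespace HilbAlg

instance : CoeSort HilbAlg.{u} (Type u) := ⟨HilbAlg.carrier⟩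

attribute [instance] HilbAlg.normed HilbAlg.ips HilbAlg.complete

/-- A morphism of semigroup objects: a bounded linear map that commutes with the
multiplications. -/
@[ext]
structure Hom (A B : HilbAlg.{u}) : Type u where
  toCLM : A →L[ℂ] B
  map_mul : toCLM ∘L A.mul = B.mul ∘L hmap toCLM toCLM

variable (A : HilbAlg.{u})

/-- The bilinear product `x y = μ (x ⊗ y)`. -/
def prod (x y : A) : A := A.mul (htmul x y)

/-- The operator of multiplication by `x`. -/
def mulOp (x : A) : A →L[ℂ] A := A.mul ∘L htmulL x

/-- The comultiplication `μ†`. -/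
def comul : A →L[ℂ] HTensor A A := ContinuousLinearMap.adjoint A.mul

theorem mulOp_apply (x y : A) : A.mulOp x y = A.prod x y := rfl

variable {A}

theorem prod_comm (x y : A) : A.prod x y = A.prod y x := by
  have := congrArg (fun φ => φ (htmul x y)) A.comm
  simpa [prod] using this.symm

theorem prod_assoc (x y z : A) : A.prod (A.prod x y) z = A.prod x (A.prod y z) := by
  have := congrArg (fun φ => φ (htmul (htmul x y) z)) A.assoc
  simpa [prod] using this

theorem prod_add (x y z : A) : A.prod x (y + z) = A.prod x y + A.prod x z :=
  (A.mulOp x).map_add y z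

theorem prod_sub (x y z : A) : A.prod x (y - z) = A.prod x y - A.prod x z :=
  (A.mulOp x).map_sub y z

theorem prod_smul (c : ℂ) (x y : A) : A.prod x (c • y) = c • A.prod x y :=
  (A.mulOp x).map_smul c y

theorem prod_zero (x : A) : A.prod x 0 = 0 := (A.mulOp x).map_zero

theorem add_prod (x y z : A) : A.prod (x + y) z = A.prod x z + A.prod y z := by
  rw [prod_comm, prod_add, prod_comm z x, prod_comm z y]

theorem sub_prod (x y z : A) : A.prod (x - y) z = A.prod x z - A.prod y z := by
  rw [prod_comm, prod_sub, prod_comm z x, prod_comm z y]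

theorem smul_prod (c : ℂ) (x y : A) : A.prod (c • x) y = c • A.prod x y := by
  rw [prod_comm, prod_smul, prod_comm]

theorem zero_prod (x : A) : A.prod 0 x = 0 := by rw [prod_comm, prod_zero]

theorem norm_prod_le (x y : A) : ‖A.prod x y‖ ≤ ‖A.mul‖ * (‖x‖ * ‖y‖) := by
  rw [← norm_htmul]; exact A.mul.le_opNorm _

theorem inner_comul (x y z : A) :
    inner ℂ (A.comul x) (htmul y z) = inner ℂ x (A.prod y z) :=
  ContinuousLinearMap.adjoint_inner_left _ _ _

namespace Hom

variable {A B C : HilbAlg.{u}}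

theorem map_prod (f : Hom A B) (x y : A) : f.toCLM (A.prod x y) =
    B.prod (f.toCLM x) (f.toCLM y) := by
  have := congrArg (fun φ => φ (htmul x y)) f.map_mul
  simpa [prod] using this

/-- A bounded linear map that is multiplicative on elements is a morphism. -/
def ofProd (f : A →L[ℂ] B) (h : ∀ x y, f (A.prod x y) = B.prod (f x) (f y)) : Hom A B where
  toCLM := f
  map_mul := htensor_ext fun x y => by simpa [prod] using h x y

/-- The identity morphism. -/
def id (A : HilbAlg.{u}) : Hom A A := ofProd (ContinuousLinearMap.id ℂ A) fun _ _ => rfl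

/-- Composition of morphisms. -/
def comp (f : Hom A B) (g : Hom B C) : Hom A C :=
  ofProd (g.toCLM ∘L f.toCLM) fun x y => by simp [map_prod]

end Hom

instance : Category HilbAlg.{u} where
  Hom := Hom
  id := Hom.id
  comp := Hom.comp

@[simp] theorem id_toCLM (A : HilbAlg.{u}) :
    Hom.toCLM (𝟙 A) = ContinuousLinearMap.id ℂ A := rfl

@[simp] theorem comp_toCLM {A B C : HilbAlg.{u}} (f : A ⟶ B) (g : B ⟶ C) :
    Hom.toCLM (f ≫ g) = Hom.toCLM g ∘L Hom.toCLM f := rfl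

variable (A)

/-- The Frobenius condition, both halves of it. -/
def IsFrobenius : Prop :=
  A.comul ∘L A.mul =
      hmap A.mul (ContinuousLinearMap.id ℂ A) ∘L ((hassoc A A A).symm : _ →L[ℂ] _) ∘L
        hmap (ContinuousLinearMap.id ℂ A) A.comul ∧
    A.comul ∘L A.mul =
      hmap (ContinuousLinearMap.id ℂ A) A.mul ∘L (hassoc A A A : _ →L[ℂ] _) ∘L
        hmap A.comul (ContinuousLinearMap.id ℂ A)

variable {A}

/-- An ideal of the underlying (complex, commutative, possibly non-unital) algebra. -/
def IsIdeal (I : Submodule ℂ A) : Prop := ∀ x, ∀ y ∈ I, A.prod x y ∈ I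

/-- A minimal ideal: minimal among the non-zero ideals. -/
def IsMinimalIdeal (I : Submodule ℂ A) : Prop :=
  Minimal (fun K : Submodule ℂ A => IsIdeal K ∧ K ≠ ⊥) I

/-- A modular ideal: one with a unit `e` modulo the ideal. -/
def IsModular (I : Submodule ℂ A) : Prop := ∃ e : A, ∀ x, x - A.prod e x ∈ I

/-- A maximal modular ideal: a modular ideal that is maximal among the proper ideals. -/
def IsMaximalModular (I : Submodule ℂ A) : Prop :=
  IsModular I ∧ Maximal (fun K : Submodule ℂ A => IsIdeal K ∧ K ≠ ⊤) I

variable (A)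

/-- The Jacobson radical: the intersection of the maximal modular ideals. -/
def radical : Submodule ℂ A := sInf {I | IsMaximalModular I}

/-- Semisimplicity: the Jacobson radical is trivial. -/
def IsSemisimple : Prop := A.radical = ⊥

variable {A}

/-- A group-like element: `g ≠ 0` with `μ† g = g ⊗ g`. -/
def IsGroupLike (g : A) : Prop := g ≠ 0 ∧ A.comul g = htmul g g

theorem IsGroupLike.inner_prod {g : A} (hg : IsGroupLike g) (x y : A) :
    inner ℂ g (A.prod x y) = inner ℂ g x * inner ℂ g y := by
  rw [← inner_comul, hg.2, inner_htmul]

theorem IsGroupLike.inner_self_ne {g : A} (hg : IsGroupLike g) : (inner ℂ g g : ℂ) ≠ 0 :=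
  inner_self_ne_zero.2 hg.1

/-- Group-like elements are orthogonal to the radical. -/
theorem IsGroupLike.mem_radical_orthogonal {g : A} (hg : IsGroupLike g) :
    g ∈ A.radicalᗮ := by
  have hker : IsMaximalModular (LinearMap.ker (innerSL ℂ g).toLinearMap) := by
    refine ⟨⟨(inner ℂ g g : ℂ)⁻¹ • g, fun x => ?_⟩, ⟨fun x y hy => ?_, fun h => ?_⟩, ?_⟩
    · simp [smul_prod, inner_sub_right, inner_smul_right, hg.inner_prod, hg.1]
    · simp only [LinearMap.mem_ker, ContinuousLinearMap.coe_coe, innerSL_apply_apply] at hy ⊢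
      rw [hg.inner_prod, hy, mul_zero]
    · have : g ∈ LinearMap.ker (innerSL ℂ g).toLinearMap := h ▸ Submodule.mem_top
      exact hg.inner_self_ne (by simpa using this)
    · rintro K ⟨-, hK⟩ hle z hz
      by_contra hzk
      have hz0 : (inner ℂ g z : ℂ) ≠ 0 := by simpa using hzk
      refine hK (eq_top_iff.2 fun x _ => ?_)
      have : x - ((inner ℂ g x : ℂ) / inner ℂ g z) • z ∈ K := by
        apply hle
        simp [inner_sub_right, inner_smul_right, hz0]
      simpa using K.add_mem this (K.smul_mem ((inner ℂ g x : ℂ) / inner ℂ g z) hz)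
  refine (Submodule.mem_orthogonal _ _).2 fun x hx => ?_
  have : x ∈ LinearMap.ker (innerSL ℂ g).toLinearMap := (Submodule.mem_sInf.1 hx) _ hker
  exact inner_eq_zero_symm.1 (by simpa using this)

/-- An element with zero square lies in the radical. -/
theorem mem_radical_of_sq {x : A} (hx : A.prod x x = 0) : x ∈ A.radical := by
  refine Submodule.mem_sInf.2 fun M hM => ?_
  obtain ⟨⟨e, he⟩, ⟨hMi, hMt⟩, hmax⟩ := hM
  by_contra hxM
  let K : Submodule ℂ A := M ⊔ (ℂ ∙ x) ⊔ LinearMap.range (A.mulOp x).toLinearMap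
  have hxK : x ∈ K := Submodule.mem_sup_left
    (Submodule.mem_sup_right (Submodule.mem_span_singleton_self x))
  have hmem : ∀ z, z ∈ K ↔ ∃ m ∈ M, ∃ c : ℂ, ∃ b : A, m + c • x + A.prod x b = z := by
    intro z
    simp only [K, Submodule.mem_sup, Submodule.mem_span_singleton, LinearMap.mem_range]
    constructor
    · rintro ⟨_, ⟨m, hm, _, ⟨c, rfl⟩, rfl⟩, _, ⟨b, rfl⟩, rfl⟩
      exact ⟨m, hm, c, b, rfl⟩
    · rintro ⟨m, hm, c, b, rfl⟩
      exact ⟨_, ⟨m, hm, _, ⟨c, rfl⟩, rfl⟩, _, ⟨b, rfl⟩, rfl⟩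
  have hKi : IsIdeal K := by
    intro a z hz
    obtain ⟨m, hm, c, b, rfl⟩ := (hmem z).1 hz
    refine (hmem _).2 ⟨A.prod a m, hMi _ _ hm, 0, c • a + A.prod a b, ?_⟩
    rw [prod_add, prod_add, prod_add, prod_smul, prod_smul, zero_smul, add_zero, prod_comm x a,
      ← prod_assoc, prod_comm x a, prod_assoc, add_assoc]
  have hKt : K = ⊤ := by
    by_contra h
    exact hxM (hmax ⟨hKi, h⟩ (le_sup_left.trans le_sup_left) hxK)
  obtain ⟨m, hm, c, b, hz⟩ := (hmem e).1 (hKt ▸ Submodule.mem_top)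
  have hxe : A.prod x (c • x + A.prod x b) = 0 := by
    rw [prod_add, prod_smul, hx, ← prod_assoc, hx, zero_prod, smul_zero, add_zero]
  have hse : A.prod (c • x + A.prod x b) (c • x + A.prod x b) = 0 := by
    rw [add_prod, smul_prod, hxe, smul_zero, prod_assoc, prod_comm b, ← prod_assoc, hxe,
      zero_prod, add_zero]
  have hee : A.prod e e ∈ M := by
    rw [add_assoc] at hz
    rw [← hz, add_prod, prod_add _ m, prod_add _ m, hse, add_zero, prod_comm m (c • x + _)]
    exact M.add_mem (M.add_mem (hMi _ _ hm) (hMi _ _ hm)) (hMi _ _ hm)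
  have heM : e ∈ M := by simpa using M.add_mem (he e) hee
  refine hMt (eq_top_iff.2 fun y _ => ?_)
  have : A.prod e y ∈ M := by rw [prod_comm]; exact hMi _ _ heM
  simpa using M.add_mem (he y) this

/-- An elementwise form of the first half of the Frobenius condition. -/
theorem IsFrobenius.comul_prod (h : A.IsFrobenius) (x y : A) :
    A.comul (A.prod x y) = hmap (A.mulOp x) (ContinuousLinearMap.id ℂ A) (A.comul y) := by
  have h1 := congrArg (fun φ => φ (htmul x y)) h.1
  have h2 : hmap A.mul (ContinuousLinearMap.id ℂ A) ∘L
      ((hassoc A A A).symm : _ →L[ℂ] _) ∘L htmulL x =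
      hmap (A.mulOp x) (ContinuousLinearMap.id ℂ A) :=
    htensor_ext fun y z => by simp [htmulL_apply, mulOp]
  rw [← h2]
  simpa [htmulL_apply, prod] using h1

/-- An elementwise form of the second half of the Frobenius condition. -/
theorem IsFrobenius.comul_prod' (h : A.IsFrobenius) (x y : A) :
    A.comul (A.prod x y) = hmap (ContinuousLinearMap.id ℂ A) (A.mulOp y) (A.comul x) := by
  have h1 := congrArg (fun φ => φ (htmul x y)) h.2
  have h2 : hmap (ContinuousLinearMap.id ℂ A) A.mul ∘L
      (hassoc A A A : _ →L[ℂ] _) ∘L htmulL.flip y =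
      hmap (ContinuousLinearMap.id ℂ A) (A.mulOp y) :=
    htensor_ext fun z w => by
      have := prod_comm w y
      simp only [prod] at this
      simp [htmulL_apply, mulOp, this]
  rw [← h2]
  simpa [htmulL_apply, prod] using h1

theorem IsGroupLike.prod_eq (h : A.IsFrobenius) {g : A} (hg : IsGroupLike g) (u : A) :
    A.prod u g = (inner ℂ g u : ℂ) • g := by
  have h1 : htmul (A.prod u g) g = htmul g (A.prod u g) := by
    have e1 := h.comul_prod u g
    have e2 := h.comul_prod' g u
    rw [prod_comm g u, e1, hg.2] at e2
    simpa [mulOp_apply] using e2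
  refine ext_inner_left ℂ fun v => ?_
  have h2 := congrArg (fun t => inner ℂ (htmul g v) t) h1
  simp only [inner_htmul, hg.inner_prod] at h2
  rw [inner_smul_right]
  have h3 := hg.inner_self_ne
  apply mul_left_cancel₀ h3
  rw [← h2]; ring

theorem IsGroupLike.norm_le (h : A.IsFrobenius) {g : A} (hg : IsGroupLike g) :
    ‖g‖ ≤ ‖A.mul‖ := by
  have h1 := norm_prod_le g g
  have h0 : 0 < ‖g‖ := norm_pos_iff.2 hg.1
  rw [hg.prod_eq h, norm_smul, inner_self_eq_norm_sq_to_K] at h1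
  simp only [norm_pow, Complex.coe_algebraMap, Complex.norm_real, norm_norm] at h1
  have : (‖g‖ * ‖g‖) * ‖g‖ ≤ (‖g‖ * ‖g‖) * ‖A.mul‖ := by nlinarith
  exact le_of_mul_le_mul_left this (by positivity)

theorem IsGroupLike.inner_eq_zero (h : A.IsFrobenius) {g k : A} (hg : IsGroupLike g)
    (hk : IsGroupLike k) (hne : g ≠ k) : (inner ℂ g k : ℂ) = 0 := by
  by_contra h0
  have h0' : (inner ℂ k g : ℂ) ≠ 0 := fun h' => h0 (inner_eq_zero_symm.1 h')
  have e : (inner ℂ g k : ℂ) • g = (inner ℂ k g : ℂ) • k := by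
    rw [← hg.prod_eq h k, ← hk.prod_eq h g, prod_comm]
  have e1 : (inner ℂ g g : ℂ) = inner ℂ k g := by
    have := congrArg (fun t => (inner ℂ g t : ℂ)) e
    simp only [inner_smul_right] at this
    exact mul_left_cancel₀ h0 (by rw [this]; ring)
  have e2 : (inner ℂ k k : ℂ) = inner ℂ g k := by
    have := congrArg (fun t => (inner ℂ k t : ℂ)) e
    simp only [inner_smul_right] at this
    exact mul_left_cancel₀ h0' (by rw [← this]; ring)
  have e3 : (inner ℂ g k : ℂ) = inner ℂ k g := by
    rw [← inner_conj_symm, ← e1, inner_self_conj]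
  apply hne
  rw [← sub_eq_zero, ← inner_self_eq_zero (𝕜 := ℂ), inner_sub_left, inner_sub_right,
    inner_sub_right, e1, e2, e3]
  ring

theorem IsGroupLike.eq_of_span (h : A.IsFrobenius) {g k : A} (hg : IsGroupLike g)
    (hk : IsGroupLike k) (hs : (ℂ ∙ g) = (ℂ ∙ k)) : g = k := by
  by_contra hne
  have h1 : g ∈ (ℂ ∙ k) := hs ▸ Submodule.mem_span_singleton_self g
  obtain ⟨c, rfl⟩ := Submodule.mem_span_singleton.1 h1
  have h2 := hk.inner_eq_zero h hg (Ne.symm hne)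
  rw [inner_smul_right] at h2
  rcases mul_eq_zero.1 h2 with hc | hc
  · exact hg.1 (by rw [hc, zero_smul])
  · exact hk.inner_self_ne hc

theorem IsGroupLike.isMinimalIdeal (h : A.IsFrobenius) {g : A} (hg : IsGroupLike g) :
    IsMinimalIdeal (ℂ ∙ g) := by
  refine ⟨⟨fun x y hy => ?_, ?_⟩, fun K hK hle => ?_⟩
  · obtain ⟨c, rfl⟩ := Submodule.mem_span_singleton.1 hy
    rw [prod_smul, hg.prod_eq h]
    exact Submodule.smul_mem _ _ (Submodule.smul_mem _ _ (Submodule.mem_span_singleton_self g))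
  · simpa using hg.1
  · obtain ⟨x, hx, hx0⟩ := (Submodule.ne_bot_iff K).1 hK.2
    obtain ⟨c, rfl⟩ := Submodule.mem_span_singleton.1 (hle hx)
    have hc : c ≠ 0 := fun h' => hx0 (by rw [h', zero_smul])
    refine (Submodule.span_singleton_le_iff_mem _ _).2 ?_
    simpa [smul_smul, hc] using K.smul_mem c⁻¹ hx

/-- An idempotent whose line is an ideal is proportional to a group-like element. -/
theorem exists_groupLike_of_idem (h : A.IsFrobenius) {e : A} (he0 : e ≠ 0)
    (he : A.prod e e = e) (hI : IsIdeal (ℂ ∙ e)) :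
    ∃ g : A, IsGroupLike g ∧ (ℂ ∙ e) = (ℂ ∙ g) := by
  have hin : (inner ℂ e e : ℂ) ≠ 0 := inner_self_ne_zero.2 he0
  have h1 : A.comul e = hmap (A.mulOp e) (A.mulOp e) (A.comul e) := by
    have e1 := h.comul_prod e e
    have e2 := h.comul_prod' e e
    have e3 : hmap (A.mulOp e) (A.mulOp e) =
        hmap (A.mulOp e) (ContinuousLinearMap.id ℂ A) ∘L
          hmap (ContinuousLinearMap.id ℂ A) (A.mulOp e) := htensor_ext fun x y => by simp
    rw [he] at e1 e2
    rw [e3, ContinuousLinearMap.comp_apply, ← e2, ← e1]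
  have h2 : ∀ t, hmap (A.mulOp e) (A.mulOp e) t ∈ (ℂ ∙ (htmul e e : HTensor A A)) := by
    refine htensor_mem (Submodule.comap (hmap (A.mulOp e) (A.mulOp e)).toLinearMap
      (ℂ ∙ (htmul e e : HTensor A A)))
      ((Submodule.closed_of_finiteDimensional (ℂ ∙ (htmul e e : HTensor A A))).preimage (ContinuousLinearMap.continuous _)) ?_
    intro x y
    have hl : ∀ x, A.mulOp e x ∈ (ℂ ∙ e) := fun x => by
      rw [mulOp_apply, prod_comm]; exact hI _ _ (Submodule.mem_span_singleton_self e)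
    obtain ⟨a, ha⟩ := Submodule.mem_span_singleton.1 (hl x)
    obtain ⟨b, hb⟩ := Submodule.mem_span_singleton.1 (hl y)
    refine Submodule.mem_span_singleton.2 ⟨b * a, ?_⟩
    simp [← ha, ← hb, htmul_smul, smul_htmul, smul_smul]
  obtain ⟨c, hc⟩ := Submodule.mem_span_singleton.1 (h2 (A.comul e))
  rw [← h1] at hc
  have h3 : c * (inner ℂ e e : ℂ) = 1 := by
    have h4 := congrArg (fun t => (inner ℂ (htmul e e) t : ℂ)) hc
    have h5 : (inner ℂ (htmul e e) (A.comul e) : ℂ) = inner ℂ e e := by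
      rw [← inner_conj_symm, inner_comul, he, inner_self_conj]
    simp only [inner_smul_right, inner_htmul, h5] at h4
    apply mul_right_cancel₀ hin
    rw [one_mul, mul_assoc, h4]
  have hc0 : c ≠ 0 := fun h' => by simp [h'] at h3
  refine ⟨c • e, ⟨smul_ne_zero hc0 he0, ?_⟩, ?_⟩
  · rw [map_smul, ← hc, htmul_smul, smul_htmul]
  · exact (Submodule.span_singleton_smul_eq (IsUnit.mk0 c hc0) e).symm

/-- A minimal ideal that is orthogonal to the radical is spanned by a group-like element. -/
theorem exists_groupLike (h : A.IsFrobenius) {I : Submodule ℂ A} (hI : IsMinimalIdeal I)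
    (hIr : I ≤ A.radicalᗮ) : ∃ g : A, IsGroupLike g ∧ I = (ℂ ∙ g) := by
  obtain ⟨⟨hid, hbot⟩, hmin⟩ := hI
  have hsq : ∀ x ∈ I, x ≠ 0 → A.prod x x ≠ 0 := by
    intro x hx hx0 hxx
    have := (Submodule.mem_orthogonal _ _).1 (hIr hx) x (mem_radical_of_sq hxx)
    exact hx0 (inner_self_eq_zero.1 this)
  have hsurj : ∀ x ∈ I, x ≠ 0 → ∀ z ∈ I, ∃ y ∈ I, A.prod x y = z := by
    intro x hx hx0 z hz
    have hK : I ≤ I.map (A.mulOp x).toLinearMap := by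
      refine hmin ⟨?_, ?_⟩ ?_
      · rintro a _ ⟨y, hy, rfl⟩
        exact ⟨A.prod a y, hid _ _ hy, by
          change A.prod x (A.prod a y) = A.prod a (A.prod x y)
          rw [← prod_assoc, prod_comm x a, prod_assoc]⟩
      · exact (Submodule.ne_bot_iff _).2 ⟨_, ⟨x, hx, rfl⟩, hsq x hx hx0⟩
      · rintro _ ⟨y, hy, rfl⟩
        exact hid _ _ hy
    exact hK hz
  have hinj : ∀ x ∈ I, x ≠ 0 → ∀ y ∈ I, A.prod x y = 0 → y = 0 := by
    intro x hx hx0 y hy hxy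
    by_contra hy0
    obtain ⟨w, hw, hwx⟩ := hsurj y hy hy0 x hx
    apply hsq x hx hx0
    conv_lhs => rw [← hwx, prod_comm, hwx]
    rw [← hwx, ← prod_assoc, hwx, hxy, zero_prod]
  obtain ⟨x, hx, hx0⟩ := (Submodule.ne_bot_iff I).1 hbot
  obtain ⟨e, he, hxe⟩ := hsurj x hx hx0 x hx
  have hunit : ∀ y ∈ I, A.prod e y = y := by
    intro y hy
    have := hinj x hx hx0 (A.prod e y - y) (I.sub_mem (hid _ _ hy) hy) (by
      rw [prod_sub, ← prod_assoc, hxe, sub_self])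
    exact sub_eq_zero.1 this
  have he0 : e ≠ 0 := fun h' => hx0 (by rw [← hxe, h', prod_zero])
  have hclosed : IsClosed (I : Set A) := by
    have : (I : Set A) = {y | A.mulOp e y = y} := by
      ext y
      refine ⟨fun hy => hunit y hy, fun hy => ?_⟩
      have hy' : A.prod e y = y := hy
      rw [SetLike.mem_coe, ← hy', prod_comm]
      exact hid _ _ he
    rw [this]
    exact isClosed_eq (A.mulOp e).continuous continuous_id
  have : CompleteSpace I := hclosed.completeSpace_coe
  have : Nontrivial I := ⟨⟨⟨e, he⟩, 0, fun h' => he0 (congrArg Subtype.val h')⟩⟩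
  let R : A → (I →L[ℂ] I) := fun z =>
    ((A.mulOp z) ∘L I.subtypeL).codRestrict I fun y => hid _ _ y.2
  have hR : ∀ z (y : I), ((R z y : I) : A) = A.prod z y := fun _ _ => rfl
  have hline : ∀ y ∈ I, ∃ c : ℂ, c • e = y := by
    intro y hy
    obtain ⟨c, hc⟩ := spectrum.nonempty (R y)
    refine ⟨c, ?_⟩
    by_contra hne
    obtain ⟨w, hw, hzw⟩ := hsurj (c • e - y) (I.sub_mem (I.smul_mem c he) hy)
      (sub_ne_zero.2 hne) e he
    apply hc
    have e1 : algebraMap ℂ (I →L[ℂ] I) c - R y = R (c • e - y) := by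
      ext t
      rw [hR, sub_prod, smul_prod, hunit _ t.2]
      rfl
    have e2 : R (c • e - y) * R w = 1 := by
      ext t
      change A.prod (c • e - y) (A.prod w t) = t
      rw [← prod_assoc, hzw, hunit _ t.2]
    have e3 : R w * R (c • e - y) = 1 := by
      ext t
      change A.prod w (A.prod (c • e - y) t) = t
      rw [← prod_assoc, prod_comm w, hzw, hunit _ t.2]
    rw [spectrum.mem_resolventSet_iff, e1]
    exact ⟨⟨_, _, e2, e3⟩, rfl⟩
  have hspan : I = (ℂ ∙ e) := by
    refine le_antisymm (fun y hy => Submodule.mem_span_singleton.2 (hline y hy))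
      ((Submodule.span_singleton_le_iff_mem _ _).2 he)
  obtain ⟨g, hg, hge⟩ := exists_groupLike_of_idem h he0 (hunit e he) (hspan ▸ hid)
  exact ⟨g, hg, hspan.trans hge⟩

/-- The adjoint of a morphism sends a group-like element to a group-like element or to zero. -/
theorem IsGroupLike.adjoint {B : HilbAlg.{u}} (f : A ⟶ B) {g : B} (hg : IsGroupLike g) :
    ContinuousLinearMap.adjoint (Hom.toCLM f) g = 0 ∨
      IsGroupLike (ContinuousLinearMap.adjoint (Hom.toCLM f) g) := by
  refine or_iff_not_imp_left.2 fun h0 => ⟨h0, htensor_ext_inner fun x y => ?_⟩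
  rw [inner_comul, ContinuousLinearMap.adjoint_inner_left, Hom.map_prod, hg.inner_prod,
    inner_htmul, ContinuousLinearMap.adjoint_inner_left, ContinuousLinearMap.adjoint_inner_left]

end HilbAlg

/-! ### Weighted pointed sets -/

/-- A pointed set with a weight function off the base point that is bounded below by some
positive constant. -/
structure WPSet : Type (u + 1) where
  carrier : Type u
  pt : carrier
  weight : {x : carrier // x ≠ pt} → ℝ
  exists_le : ∃ C : ℝ, 0 < C ∧ ∀ x, C ≤ weight x

namespace WPSet

/-- The points other than the base point. -/
abbrev Off (X : WPSet.{u}) : Type u := {x : X.carrier // x ≠ X.pt}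

theorem weight_pos (X : WPSet.{u}) (x : X.Off) : 0 < X.weight x := by
  obtain ⟨C, hC, h⟩ := X.exists_le
  exact hC.trans_le (h x)

/-- A base-point preserving map, with finite fibres off the base point, that is bounded with
respect to the weights. -/
@[ext]
structure Hom (X Y : WPSet.{u}) : Type u where
  toFun : X.carrier → Y.carrier
  map_pt : toFun X.pt = Y.pt
  finite_fiber : ∀ y, y ≠ Y.pt → (toFun ⁻¹' {y}).Finite
  exists_bound : ∃ M : ℝ, 0 ≤ M ∧ ∀ y : Y.Off,
    ∑ᶠ x ∈ {x : X.Off | toFun x = y}, X.weight x ≤ M * Y.weight y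

variable {X Y Z : WPSet.{u}}

/-- The weight bound of a morphism, for finite sets of points. -/
theorem Hom.exists_finset_bound (f : Hom X Y) : ∃ M : ℝ, 0 ≤ M ∧ ∀ (y : Y.Off)
    (s : Finset X.Off), (∀ x ∈ s, f.toFun x = y) → ∑ x ∈ s, X.weight x ≤ M * Y.weight y := by
  obtain ⟨M, hM, h⟩ := f.exists_bound
  refine ⟨M, hM, fun y s hs => le_trans ?_ (h y)⟩
  have hfin : {x : X.Off | f.toFun x = y}.Finite :=
    Set.Finite.of_finite_image ((f.finite_fiber y y.2).subset (by rintro _ ⟨x, hx, rfl⟩; exact hx))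
      Subtype.val_injective.injOn
  rw [finsum_mem_eq_finite_toFinset_sum _ hfin]
  exact Finset.sum_le_sum_of_subset_of_nonneg (fun x hx => by simpa using hs x hx)
    fun x _ _ => (X.weight_pos x).le

/-- A base-point preserving map that satisfies the weight bound for finite sets of points is a
morphism. -/
def Hom.ofFinset (f : X.carrier → Y.carrier) (hf : f X.pt = Y.pt)
    (hb : ∃ M : ℝ, 0 ≤ M ∧ ∀ (y : Y.Off) (s : Finset X.Off), (∀ x ∈ s, f x = y) →
      ∑ x ∈ s, X.weight x ≤ M * Y.weight y) : Hom X Y :=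
  have hfin : ∀ y : Y.Off, {x : X.Off | f x = y}.Finite := by
    intro y
    obtain ⟨M, -, h⟩ := hb
    obtain ⟨C, hC, hw⟩ := X.exists_le
    by_contra hinf
    obtain ⟨n, hn⟩ := exists_nat_gt (M * Y.weight y / C)
    obtain ⟨s, hs, hcard⟩ := Set.Infinite.exists_subset_card_eq hinf n
    have h1 := h y s fun x hx => hs hx
    have h2 : (n : ℝ) * C ≤ ∑ x ∈ s, X.weight x := by
      rw [← hcard, ← nsmul_eq_mul]
      exact Finset.card_nsmul_le_sum _ _ _ fun x _ => hw x
    rw [div_lt_iff₀ hC] at hn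
    linarith
  { toFun := f
    map_pt := hf
    finite_fiber := fun y hy => by
      refine ((hfin ⟨y, hy⟩).image Subtype.val).subset fun x hx => ?_
      have hx' : f x = y := hx
      exact ⟨⟨x, fun h => hy (by rw [← hx', h, hf])⟩, hx, rfl⟩
    exists_bound := by
      obtain ⟨M, hM, h⟩ := hb
      refine ⟨M, hM, fun y => ?_⟩
      rw [finsum_mem_eq_finite_toFinset_sum _ (hfin y)]
      exact h y _ fun x hx => by simpa using hx }

/-- The identity morphism. -/
def Hom.id (X : WPSet.{u}) : Hom X X :=
  Hom.ofFinset _root_.id rfl ⟨1, zero_le_one, fun y s hs => by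
    have hsub : s ⊆ {y} := fun x hx => by simpa using Subtype.ext (hs x hx)
    calc ∑ x ∈ s, X.weight x ≤ ∑ x ∈ {y}, X.weight x :=
          Finset.sum_le_sum_of_subset_of_nonneg hsub fun x _ _ => (X.weight_pos x).le
      _ = 1 * X.weight y := by simp⟩

/-- Composition of morphisms. -/
def Hom.comp (f : Hom X Y) (g : Hom Y Z) : Hom X Z :=
  Hom.ofFinset (g.toFun ∘ f.toFun) (by simp [f.map_pt, g.map_pt]) (by
    classical
    obtain ⟨M, hM, hf⟩ := f.exists_finset_bound
    obtain ⟨N, hN, hg⟩ := g.exists_finset_bound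
    refine ⟨M * N, mul_nonneg hM hN, fun z s hs => ?_⟩
    have hne : ∀ x ∈ s, f.toFun x ≠ Y.pt := fun x hx h => z.2 (by
      rw [← hs x hx, Function.comp_apply, h, g.map_pt])
    let t : Finset Y.Off := s.attach.image fun x => ⟨f.toFun x.1, hne x.1 x.2⟩
    have ht : ∀ y ∈ t, g.toFun y = z := by
      intro y hy
      obtain ⟨x, -, rfl⟩ := Finset.mem_image.1 hy
      exact hs x.1 x.2
    calc ∑ x ∈ s, X.weight x = ∑ y ∈ t, ∑ x ∈ s.filter (fun x : X.Off => f.toFun x = y), X.weight x := by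
          rw [← Finset.sum_attach]
          rw [← Finset.sum_fiberwise_of_maps_to (t := t)
            (g := fun x : s => (⟨f.toFun x.1, hne x.1 x.2⟩ : Y.Off))
            (fun x hx => Finset.mem_image_of_mem _ hx)]
          refine Finset.sum_congr rfl fun y _ => ?_
          rw [Finset.sum_filter, Finset.sum_filter, ← Finset.sum_attach s]
          refine Finset.sum_congr rfl fun x _ => ?_
          simp [Subtype.ext_iff]
      _ ≤ ∑ y ∈ t, M * Y.weight y := Finset.sum_le_sum fun y _ => hf y _ fun x hx => by
          simpa using (Finset.mem_filter.1 hx).2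
      _ = M * ∑ y ∈ t, Y.weight y := by rw [Finset.mul_sum]
      _ ≤ M * (N * Z.weight z) := mul_le_mul_of_nonneg_left (hg z t ht) hM
      _ = M * N * Z.weight z := by ring)

instance : Category WPSet.{u} where
  Hom := Hom
  id := Hom.id
  comp := Hom.comp

@[simp] theorem id_toFun (X : WPSet.{u}) : Hom.toFun (𝟙 X) = _root_.id := rfl

@[simp] theorem comp_toFun (f : X ⟶ Y) (g : Y ⟶ Z) :
    Hom.toFun (f ≫ g) = Hom.toFun g ∘ Hom.toFun f := rfl

theorem hom_ext {f g : X ⟶ Y} (h : ∀ x, Hom.toFun f x = Hom.toFun g x) : f = g :=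
  Hom.ext (funext h)

/-- The functor that forgets the weights. -/
def forgetWeight : WPSet.{u} ⥤ Pointed.{u} where
  obj X := ⟨X.carrier, X.pt⟩
  map f := ⟨Hom.toFun f, Hom.map_pt f⟩

end WPSet

/-! ### Hilbertian Frobenius semigroups -/

/-- The category of commutative Hilbertian Frobenius semigroups: the full subcategory of the
commutative Hilbertian algebras that satisfy the Frobenius condition. -/
abbrev FrobSem : Type (u + 1) :=
  ObjectProperty.FullSubcategory fun A : HilbAlg.{u} => A.IsFrobenius

/-- The category of semisimple commutative Hilbertian Frobenius semigroups. -/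
abbrev SemisimpleFrobSem : Type (u + 1) :=
  ObjectProperty.FullSubcategory fun A : FrobSem.{u} => A.obj.IsSemisimple

/-- The category of finite-dimensional semisimple commutative Hilbertian Frobenius semigroups. -/
abbrev FdSemisimpleFrobSem : Type (u + 1) :=
  ObjectProperty.FullSubcategory fun A : SemisimpleFrobSem.{u} =>
    FiniteDimensional ℂ A.obj.obj.carrier

/-- The category of finite pointed sets and base-point preserving maps. -/
abbrev FinPointed : Type (u + 1) :=
  ObjectProperty.FullSubcategory fun X : Pointed.{u} => Finite X

/-! ### The functor of minimal ideals -/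

namespace HilbAlg

variable (A : HilbAlg.{u})

/-- The minimal ideals contained in the orthogonal complement of the radical, with the zero ideal
added. -/
def MinIdeal : Type u :=
  {I : Submodule ℂ A // I = ⊥ ∨ (IsMinimalIdeal I ∧ I ≤ A.radicalᗮ)}

variable {A}

open Classical in
/-- The group-like generator of a minimal ideal (and `0` for the zero ideal). -/
def gen (I : Submodule ℂ A) : A :=
  if h : ∃ g : A, IsGroupLike g ∧ I = (ℂ ∙ g) then h.choose else 0

theorem gen_span (h : A.IsFrobenius) {g : A} (hg : IsGroupLike g) : gen (ℂ ∙ g) = g := by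
  have hex : ∃ k : A, IsGroupLike k ∧ (ℂ ∙ g) = (ℂ ∙ k) := ⟨g, hg, rfl⟩
  rw [gen, dif_pos hex]
  exact (hg.eq_of_span h hex.choose_spec.1 hex.choose_spec.2).symm

theorem gen_bot : gen (⊥ : Submodule ℂ A) = 0 := by
  rw [gen, dif_neg]
  rintro ⟨g, hg, h⟩
  exact hg.1 (Submodule.span_singleton_eq_bot.1 h.symm)

theorem MinIdeal.gen_spec (h : A.IsFrobenius) (I : A.MinIdeal) (hI : I.1 ≠ ⊥) :
    IsGroupLike (gen I.1) ∧ I.1 = (ℂ ∙ gen I.1) := by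
  obtain ⟨hm, hr⟩ := I.2.resolve_left hI
  have hex := exists_groupLike h hm hr
  rw [gen, dif_pos hex]
  exact hex.choose_spec

theorem MinIdeal.span_gen (h : A.IsFrobenius) (I : A.MinIdeal) : (ℂ ∙ gen I.1) = I.1 := by
  by_cases hI : I.1 = ⊥
  · rw [hI, gen_bot, Submodule.span_zero_singleton]
  · exact (I.gen_spec h hI).2.symm

theorem MinIdeal.gen_eq_zero_or (h : A.IsFrobenius) (I : A.MinIdeal) :
    gen I.1 = 0 ∨ IsGroupLike (gen I.1) := by
  by_cases hI : I.1 = ⊥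
  · left; rw [hI, gen_bot]
  · exact Or.inr (I.gen_spec h hI).1

/-- The line spanned by `g` when `g` is group-like or zero. -/
def lineOf (h : A.IsFrobenius) (g : A) (hg : g = 0 ∨ IsGroupLike g) : A.MinIdeal :=
  ⟨ℂ ∙ g, hg.imp (fun h0 => by rw [h0, Submodule.span_zero_singleton]) fun hg =>
    ⟨hg.isMinimalIdeal h, (Submodule.span_singleton_le_iff_mem _ _).2 hg.mem_radical_orthogonal⟩⟩

theorem adjoint_gen {B : HilbAlg.{u}} (f : A ⟶ B) (h : B.IsFrobenius) (J : B.MinIdeal) :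
    ContinuousLinearMap.adjoint (Hom.toCLM f) (gen J.1) = 0 ∨
      IsGroupLike (ContinuousLinearMap.adjoint (Hom.toCLM f) (gen J.1)) := by
  rcases J.gen_eq_zero_or h with h0 | h0
  · left; rw [h0, map_zero]
  · exact h0.adjoint f

theorem gen_lineOf (h : A.IsFrobenius) (g : A) (hg : g = 0 ∨ IsGroupLike g) :
    gen (lineOf h g hg).1 = g := by
  rcases hg with h0 | hg
  · subst h0
    change gen (ℂ ∙ (0 : A)) = 0
    rw [Submodule.span_zero_singleton, gen_bot]
  · exact gen_span h hg

end HilbAlg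

open HilbAlg in
/-- The weighted pointed set of a Hilbertian Frobenius semigroup: its minimal ideals (with `0` as
the base point), and the weight `‖g‖⁻²` of the ideal with group-like generator `g`. -/
def minObj (A : FrobSem.{u}) : WPSet.{u} where
  carrier := A.obj.MinIdeal
  pt := ⟨⊥, Or.inl rfl⟩
  weight I := 1 / ‖gen I.1.1‖ ^ 2
  exists_le := by
    refine ⟨1 / (‖A.obj.mul‖ + 1) ^ 2, by positivity, fun I => ?_⟩
    have hI : I.1.1 ≠ ⊥ := fun h => I.2 (Subtype.ext h)
    have hg := (I.1.gen_spec A.property hI).1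
    have h0 : 0 < ‖gen I.1.1‖ := norm_pos_iff.2 hg.1
    have h1 := hg.norm_le A.property
    gcongr
    linarith

theorem minObj_isGroupLike (A : FrobSem.{u}) (I : (minObj A).Off) :
    HilbAlg.IsGroupLike (HilbAlg.gen I.1.1) :=
  (I.1.gen_spec A.property fun h => I.2 (Subtype.ext h)).1

open HilbAlg in
/-- The map `J ↦ ℂ f†(g_J)` between sets of minimal ideals, `g_J` being the group-like generator
of `J`. -/
def minMap {A B : FrobSem.{u}} (f : A ⟶ B) : minObj B ⟶ minObj A :=
  WPSet.Hom.ofFinset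
    (fun J : B.obj.MinIdeal => lineOf A.property
      (ContinuousLinearMap.adjoint (Hom.toCLM f.hom) (gen J.1))
      (adjoint_gen f.hom B.property J))
    (by
      refine Subtype.ext ?_
      change (ℂ ∙ ContinuousLinearMap.adjoint (Hom.toCLM f.hom) (gen ⊥)) = ⊥
      rw [gen_bot, map_zero, Submodule.span_zero_singleton])
    (by
      classical
      refine ⟨‖Hom.toCLM f.hom‖ ^ 2, by positivity, fun I s hs => ?_⟩
      have hgI := minObj_isGroupLike A I
      set g : A.obj := gen I.1.1 with hg
      have hn : 0 < ‖g‖ := norm_pos_iff.2 hgI.1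
      have hadj : ∀ J ∈ s, ContinuousLinearMap.adjoint (Hom.toCLM f.hom) (gen J.1.1) = g := by
        intro J hJ
        rw [hg, ← hs J hJ]
        exact (gen_lineOf A.property _ _).symm
      let e : A.obj := ((‖g‖ ^ 2 : ℝ) : ℂ)⁻¹ • g
      have hge : (inner ℂ g e : ℂ) = 1 := by
        have h1 : ((‖g‖ : ℝ) : ℂ) ≠ 0 := by exact_mod_cast hn.ne'
        simp only [e, inner_smul_right, inner_self_eq_norm_sq_to_K]
        push_cast
        field_simp
        simp
      have hne : ‖e‖ ^ 2 = 1 / ‖g‖ ^ 2 := by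
        simp only [e, norm_smul, norm_inv, Complex.norm_real, norm_pow, norm_norm]
        field_simp
      let v : (minObj B).Off → B.obj := fun J => ((‖gen J.1.1‖ : ℝ) : ℂ)⁻¹ • gen J.1.1
      have hv : Orthonormal ℂ v := by
        refine ⟨fun J => ?_, fun J J' hJJ' => ?_⟩
        · have h0 : ‖gen J.1.1‖ ≠ 0 := norm_ne_zero_iff.2 (minObj_isGroupLike B J).1
          simp only [v, norm_smul, norm_inv, Complex.norm_real, norm_norm]
          field_simp
        · simp only [v, inner_smul_left, inner_smul_right]
          rw [(minObj_isGroupLike B J).inner_eq_zero B.property (minObj_isGroupLike B J')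
            fun h => hJJ' (Subtype.ext (Subtype.ext (by
              rw [← J.1.span_gen B.property, ← J'.1.span_gen B.property, h]))), mul_zero, mul_zero]
      calc ∑ J ∈ s, (minObj B).weight J
          = ∑ J ∈ s, ‖(inner ℂ (v J) (Hom.toCLM f.hom e) : ℂ)‖ ^ 2 := by
            refine Finset.sum_congr rfl fun J hJ => ?_
            have h1 : (inner ℂ (gen J.1.1) (Hom.toCLM f.hom e) : ℂ) = 1 := by
              rw [← ContinuousLinearMap.adjoint_inner_left, hadj J hJ, hge]
            simp only [v, inner_smul_left, h1]
            simp [minObj]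
        _ ≤ ‖Hom.toCLM f.hom e‖ ^ 2 := hv.sum_inner_products_le _
        _ ≤ (‖Hom.toCLM f.hom‖ * ‖e‖) ^ 2 := by
            gcongr; exact (Hom.toCLM f.hom).le_opNorm e
        _ = ‖Hom.toCLM f.hom‖ ^ 2 * (minObj A).weight I := by
            rw [mul_pow, hne]; rfl)

theorem minMap_val {A B : FrobSem.{u}} (f : A ⟶ B) (J : B.obj.MinIdeal) :
    (WPSet.Hom.toFun (minMap f) J : A.obj.MinIdeal).1 =
      (ℂ ∙ ContinuousLinearMap.adjoint (HilbAlg.Hom.toCLM f.hom) (HilbAlg.gen J.1)) := rfl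

theorem gen_minMap {A B : FrobSem.{u}} (f : A ⟶ B) (J : B.obj.MinIdeal) :
    HilbAlg.gen (WPSet.Hom.toFun (minMap f) J : A.obj.MinIdeal).1 =
      ContinuousLinearMap.adjoint (HilbAlg.Hom.toCLM f.hom) (HilbAlg.gen J.1) :=
  HilbAlg.gen_lineOf A.property _ (HilbAlg.adjoint_gen f.hom B.property J)

/-- The functor `Min_•`. -/
def minFunctor : FrobSem.{u} ⥤ WPSet.{u}ᵒᵖ where
  obj A := Opposite.op (minObj A)
  map f := (minMap f).op
  map_id A := by
    refine congrArg Quiver.Hom.op (WPSet.hom_ext fun J => Subtype.ext ?_)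
    refine (minMap_val _ J).trans ?_
    change (ℂ ∙ ContinuousLinearMap.adjoint (ContinuousLinearMap.id ℂ A.obj)
      (HilbAlg.gen (A := A.obj) J.1)) = _
    rw [ContinuousLinearMap.adjoint_id]
    exact HilbAlg.MinIdeal.span_gen A.property J
  map_comp {A B C} f g := by
    refine congrArg Quiver.Hom.op (WPSet.hom_ext fun J => Subtype.ext ?_)
    refine (minMap_val _ J).trans ?_
    refine Eq.trans ?_ (minMap_val f (WPSet.Hom.toFun (minMap g) J)).symm
    refine congrArg (fun v => (ℂ ∙ v)) ?_
    refine Eq.trans ?_ (congrArg (ContinuousLinearMap.adjoint (HilbAlg.Hom.toCLM f.hom))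
      (gen_minMap g J)).symm
    exact DFunLike.congr_fun (ContinuousLinearMap.adjoint_comp
      (HilbAlg.Hom.toCLM g.hom) (HilbAlg.Hom.toCLM f.hom)) _

/-! ### Weighted `ℓ²` spaces -/

/-- The functions on a weighted pointed set that vanish at the base point and are square-summable
with respect to the weight. -/
def ell2Submodule (X : WPSet.{u}) : Submodule ℂ (X.carrier → ℂ) where
  carrier := {v | v X.pt = 0 ∧ Summable fun x : X.Off => X.weight x * ‖v x‖ ^ 2}
  zero_mem' := ⟨rfl, by simp⟩
  add_mem' := by
    rintro a b ⟨ha0, ha⟩ ⟨hb0, hb⟩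
    refine ⟨by simp [ha0, hb0], ((ha.mul_left 2).add (hb.mul_left 2)).of_nonneg_of_le
      (fun x => mul_nonneg (X.weight_pos x).le (sq_nonneg _)) fun x => ?_⟩
    have h1 : ‖a x + b x‖ ^ 2 ≤ 2 * ‖a x‖ ^ 2 + 2 * ‖b x‖ ^ 2 := by
      have := norm_add_le (a x) (b x)
      nlinarith [sq_nonneg (‖a x‖ - ‖b x‖), norm_nonneg (a x + b x)]
    have h2 := mul_le_mul_of_nonneg_left h1 (X.weight_pos x).le
    simp only [Pi.add_apply]
    linarith
  smul_mem' := by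
    rintro c a ⟨ha0, ha⟩
    refine ⟨by simp [ha0], (ha.mul_left (‖c‖ ^ 2)).congr fun x => ?_⟩
    simp only [Pi.smul_apply, smul_eq_mul, norm_mul]
    ring

/-- The weighted space `ℓ²_•(X)`. -/
def Ell2 (X : WPSet.{u}) : Type u := ell2Submodule X

namespace Ell2

variable {X Y Z : WPSet.{u}}

instance : AddCommGroup (Ell2 X) := inferInstanceAs (AddCommGroup (ell2Submodule X))

instance : Module ℂ (Ell2 X) := inferInstanceAs (Module ℂ (ell2Submodule X))

instance : CoeFun (Ell2 X) fun _ => X.carrier → ℂ := ⟨fun v => v.1⟩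

@[ext] theorem ext {v w : Ell2 X} (h : ∀ x, v x = w x) : v = w := Subtype.ext (funext h)

@[simp] theorem pt_eq (v : Ell2 X) : v X.pt = 0 := v.2.1

theorem summable (v : Ell2 X) : Summable fun x : X.Off => X.weight x * ‖v x‖ ^ 2 := v.2.2

@[simp] theorem add_apply (v w : Ell2 X) (x : X.carrier) : (v + w) x = v x + w x := rfl

@[simp] theorem smul_apply (c : ℂ) (v : Ell2 X) (x : X.carrier) : (c • v) x = c * v x := rfl

@[simp] theorem zero_apply (x : X.carrier) : (0 : Ell2 X) x = 0 := rfl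

theorem ext_off {v w : Ell2 X} (h : ∀ x : X.Off, v x = w x) : v = w := by
  ext x
  by_cases hx : x = X.pt
  · rw [hx, pt_eq, pt_eq]
  · exact h ⟨x, hx⟩

open Classical in
/-- Rescaling identifies the weighted space with the unweighted space over the points other than
the base point. -/
def toLp (X : WPSet.{u}) : Ell2 X ≃ₗ[ℂ] lp (fun _ : X.Off => ℂ) 2 where
  toFun v := ⟨fun x => (Real.sqrt (X.weight x) : ℂ) * v x, by
    refine memℓp_gen ?_
    refine v.summable.congr fun x => ?_
    have h := Real.sq_sqrt (X.weight_pos x).le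
    simp only [norm_mul, Complex.norm_real, Real.norm_eq_abs, ENNReal.toReal_ofNat, Real.rpow_ofNat,
      mul_pow, sq_abs, h]⟩
  map_add' v w := by ext x; exact mul_add _ _ _
  map_smul' c v := by ext x; exact mul_left_comm _ _ _
  invFun f := ⟨fun x => if h : x = X.pt then 0 else
      ((Real.sqrt (X.weight ⟨x, h⟩) : ℂ))⁻¹ * f ⟨x, h⟩, by
    refine ⟨by simp, ?_⟩
    have hs := (lp.memℓp f).summable (by simp)
    refine hs.congr fun x => ?_
    have h := Real.sq_sqrt (X.weight_pos x).le
    have h' := X.weight_pos x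
    simp only [x.2, dif_neg, not_false_iff, norm_mul, norm_inv, Complex.norm_real,
      Real.norm_eq_abs, ENNReal.toReal_ofNat, Real.rpow_ofNat, mul_pow, inv_pow, sq_abs, h]
    field_simp⟩
  left_inv v := by
    refine ext_off fun x => ?_
    have h' : (Real.sqrt (X.weight x) : ℂ) ≠ 0 := by
      exact_mod_cast (Real.sqrt_pos.2 (X.weight_pos x)).ne'
    refine (dif_neg x.2).trans ?_
    change (Real.sqrt (X.weight x) : ℂ)⁻¹ * ((Real.sqrt (X.weight x) : ℂ) * v x) = v x
    field_simp
  right_inv f := by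
    ext x
    have h' : (Real.sqrt (X.weight x) : ℂ) ≠ 0 := by
      exact_mod_cast (Real.sqrt_pos.2 (X.weight_pos x)).ne'
    refine (congrArg (fun z => (Real.sqrt (X.weight x) : ℂ) * z) (dif_neg x.2)).trans ?_
    exact mul_inv_cancel_left₀ h' _

theorem toLp_apply (v : Ell2 X) (x : X.Off) :
    toLp X v x = (Real.sqrt (X.weight x) : ℂ) * v x := rfl

theorem inner_term (v w : Ell2 X) (x : X.Off) : inner ℂ (toLp X v x) (toLp X w x) =
    (X.weight x : ℂ) * (starRingEnd ℂ (v x) * w x) := by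
  have h : (X.weight x : ℂ) = (Real.sqrt (X.weight x) : ℂ) * (Real.sqrt (X.weight x) : ℂ) := by
    exact_mod_cast (Real.mul_self_sqrt (X.weight_pos x).le).symm
  rw [toLp_apply, toLp_apply, h, RCLike.inner_apply]
  simp only [map_mul, Complex.conj_ofReal]
  ring

theorem toLp_inner (v w : Ell2 X) : inner ℂ (toLp X v) (toLp X w) =
    ∑' x : X.Off, (X.weight x : ℂ) * (starRingEnd ℂ (v x) * w x) := by
  rw [lp.inner_eq_tsum]
  exact tsum_congr fun x => inner_term v w x

instance : NormedAddCommGroup (Ell2 X) :=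
  NormedAddCommGroup.induced (Ell2 X) (lp (fun _ : X.Off => ℂ) 2) (toLp X) (toLp X).injective

theorem norm_toLp (v : Ell2 X) : ‖toLp X v‖ = ‖v‖ := rfl

instance : NormedSpace ℂ (Ell2 X) :=
  NormedSpace.induced ℂ (Ell2 X) (lp (fun _ : X.Off => ℂ) 2) (toLp X)

/-- The inner product `∑ α(x) conj(v(x)) w(x)`. -/
instance : InnerProductSpace ℂ (Ell2 X) where
  inner v w := ∑' x : X.Off, (X.weight x : ℂ) * (starRingEnd ℂ (v x) * w x)
  norm_sq_eq_re_inner v := by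
    rw [← toLp_inner, ← norm_toLp, inner_self_eq_norm_sq]
  conj_inner_symm v w := by
    rw [← toLp_inner, ← toLp_inner, inner_conj_symm]
  add_left u v w := by
    rw [← toLp_inner, ← toLp_inner, ← toLp_inner, map_add, inner_add_left]
  smul_left v w c := by
    rw [← toLp_inner, ← toLp_inner, map_smul, inner_smul_left]

theorem inner_eq (v w : Ell2 X) :
    inner ℂ v w = ∑' x : X.Off, (X.weight x : ℂ) * (starRingEnd ℂ (v x) * w x) := rfl

/-- The rescaling as a linear isometric equivalence. -/
def toLpₗᵢ (X : WPSet.{u}) : Ell2 X ≃ₗᵢ[ℂ] lp (fun _ : X.Off => ℂ) 2 where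
  __ := toLp X
  norm_map' := norm_toLp

instance : CompleteSpace (Ell2 X) :=
  (toLpₗᵢ X).toIsometryEquiv.completeSpace_iff.2 inferInstance

theorem hasSum_norm_sq (v : Ell2 X) :
    HasSum (fun x : X.Off => X.weight x * ‖v x‖ ^ 2) (‖v‖ ^ 2) := by
  have h := lp.hasSum_norm (p := 2) (by simp) (toLp X v)
  rw [norm_toLp] at h
  simp only [ENNReal.toReal_ofNat, Real.rpow_ofNat] at h
  convert! h using 2 with x
  rw [toLp_apply, norm_mul, mul_pow, Complex.norm_real, Real.norm_eq_abs, sq_abs,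
    Real.sq_sqrt (X.weight_pos x).le]

theorem weight_mul_le (v : Ell2 X) (x : X.Off) : X.weight x * ‖v x‖ ^ 2 ≤ ‖v‖ ^ 2 :=
  le_hasSum (hasSum_norm_sq v) x fun y _ => mul_nonneg (X.weight_pos y).le (sq_nonneg _)

theorem norm_sq_le {v : Ell2 X} {c : ℝ}
    (h : ∀ s : Finset X.Off, ∑ x ∈ s, X.weight x * ‖v x‖ ^ 2 ≤ c) : ‖v‖ ^ 2 ≤ c :=
  hasSum_le_of_sum_le (hasSum_norm_sq v) h

open Classical in
/-- The indicator function of a point other than the base point. -/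
def single (x : X.Off) : Ell2 X :=
  ⟨Pi.single x.1 1, by simp [x.2.symm], by
    refine summable_of_ne_finset_zero (s := {x}) fun y hy => ?_
    have : y.1 ≠ x.1 := fun h => hy (by simpa using Subtype.ext h)
    simp [this]⟩

open Classical in
theorem single_apply (x : X.Off) (y : X.carrier) :
    single x y = if y = x then 1 else 0 := by
  change (Pi.single x.1 1 : X.carrier → ℂ) y = _
  rw [Pi.single_apply]

theorem inner_single (x : X.Off) (v : Ell2 X) :
    inner ℂ (single x) v = (X.weight x : ℂ) * v x := by
  classical
  rw [inner_eq, tsum_eq_single x]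
  · simp [single_apply]
  · intro y hy
    have : y.1 ≠ x.1 := fun h => hy (Subtype.ext h)
    simp [single_apply, this]

/-- Bounded maps on the weighted space are determined by their values at the indicator
functions. -/
theorem clm_ext {E : Type*} [NormedAddCommGroup E] [NormedSpace ℂ E] {f g : Ell2 X →L[ℂ] E}
    (h : ∀ x, f (single x) = g (single x)) : f = g := by
  let S : Submodule ℂ (Ell2 X) := LinearMap.eqLocus (f : Ell2 X →ₗ[ℂ] E) g
  have hS : IsClosed (S : Set (Ell2 X)) := isClosed_eq f.continuous g.continuous
  have : CompleteSpace S := hS.completeSpace_coe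
  have htop : S = ⊤ := by
    rw [← Submodule.orthogonal_eq_bot_iff, Submodule.eq_bot_iff]
    intro v hv
    refine ext_off fun x => ?_
    have := (Submodule.mem_orthogonal _ _).1 hv (single x) (h x)
    rw [inner_single] at this
    have hw : (X.weight x : ℂ) ≠ 0 := by exact_mod_cast (X.weight_pos x).ne'
    simpa [hw] using this
  ext v
  exact (htop ▸ Submodule.mem_top : v ∈ S)

/-- The pointwise product. -/
def pmul (v w : Ell2 X) : Ell2 X :=
  ⟨fun x => v x * w x, by simp, by
    obtain ⟨C, hC, hX⟩ := X.exists_le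
    refine (v.summable.mul_right (‖w‖ ^ 2 / C)).of_nonneg_of_le
      (fun x => mul_nonneg (X.weight_pos x).le (sq_nonneg _)) fun x => ?_
    have h1 : ‖w x‖ ^ 2 ≤ ‖w‖ ^ 2 / C := by
      rw [le_div_iff₀ hC]
      have := weight_mul_le w x
      nlinarith [hX x, sq_nonneg ‖w x‖]
    rw [norm_mul, mul_pow, ← mul_assoc]
    exact mul_le_mul_of_nonneg_left h1 (mul_nonneg (X.weight_pos x).le (sq_nonneg _))⟩

@[simp] theorem pmul_apply (v w : Ell2 X) (x : X.carrier) : pmul v w x = v x * w x := rfl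

/-- The pointwise product as a linear map on the algebraic tensor product. -/
def mulAlg (X : WPSet.{u}) : Ell2 X ⊗[ℂ] Ell2 X →ₗ[ℂ] Ell2 X :=
  TensorProduct.lift (LinearMap.mk₂ ℂ pmul
    (fun v v' w => by ext x; simp [add_mul])
    (fun c v w => by ext x; simp [mul_assoc])
    (fun v w w' => by ext x; simp [mul_add])
    (fun c v w => by ext x; simp [mul_left_comm]))

@[simp] theorem mulAlg_tmul (v w : Ell2 X) : mulAlg X (v ⊗ₜ w) = pmul v w := rfl

theorem inner_single_tmul (x : X.Off) (t : Ell2 X ⊗[ℂ] Ell2 X) :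
    inner ℂ (single x ⊗ₜ[ℂ] single x) t = (X.weight x : ℂ) ^ 2 * mulAlg X t x := by
  induction t using TensorProduct.induction_on with
  | zero => simp
  | tmul v w => simp [inner_single]; ring
  | add s t hs ht => rw [inner_add_right, hs, ht, map_add, add_apply]; ring

theorem inner_smul_tmul (c : ℂ) (s t : Ell2 X ⊗[ℂ] Ell2 X) :
    inner ℂ (c • s) t = starRingEnd ℂ c * inner ℂ s t :=
  inner_smul_left s t c

theorem inner_smul_tmul_right (c : ℂ) (s t : Ell2 X ⊗[ℂ] Ell2 X) :
    inner ℂ s (c • t) = c * inner ℂ s t :=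
  inner_smul_right s t c

theorem exists_norm_mulAlg_le (X : WPSet.{u}) : ∃ C : ℝ, ∀ t, ‖mulAlg X t‖ ≤ C * ‖t‖ := by
  obtain ⟨C, hC, hX⟩ := X.exists_le
  refine ⟨Real.sqrt (1 / C), fun t => ?_⟩
  have hv : Orthonormal ℂ fun x : X.Off =>
      ((X.weight x : ℂ))⁻¹ • (single x ⊗ₜ[ℂ] single x) := by
    classical
    rw [orthonormal_iff_ite]
    intro x y
    have hx : (X.weight x : ℂ) ≠ 0 := by exact_mod_cast (X.weight_pos x).ne'
    rw [inner_smul_tmul, inner_smul_tmul_right, TensorProduct.inner_tmul, inner_single,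
      single_apply]
    by_cases h : x = y
    · subst h
      simp
      field_simp
    · have h' : (x : X.carrier) ≠ y := fun h' => h (Subtype.ext h')
      simp [h, h']
  have hb : ‖mulAlg X t‖ ^ 2 ≤ (1 / C) * ‖t‖ ^ 2 := by
    refine norm_sq_le fun s => ?_
    calc ∑ x ∈ s, X.weight x * ‖mulAlg X t x‖ ^ 2
        ≤ ∑ x ∈ s, (1 / C) * ‖(inner ℂ ((X.weight x : ℂ)⁻¹ • (single x ⊗ₜ[ℂ] single x)) t : ℂ)‖ ^ 2 := by
          refine Finset.sum_le_sum fun x _ => ?_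
          have hx := X.weight_pos x
          rw [inner_smul_tmul, inner_single_tmul]
          simp only [map_inv₀, Complex.conj_ofReal, norm_mul, norm_inv, norm_pow, Complex.norm_real,
            Real.norm_eq_abs, abs_of_pos hx]
          have e : (1 / C) * ((X.weight x)⁻¹ * (X.weight x ^ 2 * ‖mulAlg X t x‖)) ^ 2 =
              (X.weight x * ‖mulAlg X t x‖ ^ 2) * (X.weight x / C) := by
            field_simp
          rw [e]
          refine le_mul_of_one_le_right (mul_nonneg hx.le (sq_nonneg _)) ?_
          rw [one_le_div hC]
          exact hX x
      _ = (1 / C) * ∑ x ∈ s, ‖(inner ℂ ((X.weight x : ℂ)⁻¹ • (single x ⊗ₜ[ℂ] single x)) t : ℂ)‖ ^ 2 := by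
          rw [Finset.mul_sum]
      _ ≤ (1 / C) * ‖t‖ ^ 2 :=
          mul_le_mul_of_nonneg_left (hv.sum_inner_products_le t) (by positivity)
  refine (sq_le_sq₀ (norm_nonneg _) (by positivity)).1 ?_
  rw [mul_pow, Real.sq_sqrt (by positivity)]
  exact hb

/-- The multiplication on the Hilbertian tensor product, `v ⊗ w ↦ v w` (pointwise product). -/
def mul (X : WPSet.{u}) : HTensor (Ell2 X) (Ell2 X) →L[ℂ] Ell2 X :=
  ((mulAlg X).mkContinuousOfExistsBound (exists_norm_mulAlg_le X)).fromCompletion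

@[simp] theorem mul_htmul (v w : Ell2 X) : mul X (htmul v w) = pmul v w := by
  rw [mul, htmul, ContinuousLinearMap.fromCompletion_apply_coe]
  rfl

theorem pmul_single (v : Ell2 X) (x : X.Off) : pmul v (single x) = v x • single x := by
  classical
  ext y
  rw [pmul_apply, smul_apply, single_apply]
  split_ifs with h
  · rw [h]
  · simp

theorem pmul_comm (v w : Ell2 X) : pmul v w = pmul w v := by
  ext x; simp [mul_comm]

theorem adjoint_mul_single (x : X.Off) : ContinuousLinearMap.adjoint (mul X) (single x) =
    (X.weight x : ℂ)⁻¹ • htmul (single x) (single x) := by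
  refine htensor_ext_inner fun v w => ?_
  have hx : (X.weight x : ℂ) ≠ 0 := by exact_mod_cast (X.weight_pos x).ne'
  rw [ContinuousLinearMap.adjoint_inner_left, mul_htmul, inner_smul_left, inner_htmul,
    inner_single, inner_single, inner_single, pmul_apply]
  simp only [map_inv₀, Complex.conj_ofReal]
  field_simp

theorem frobenius_left (X : WPSet.{u}) : ContinuousLinearMap.adjoint (mul X) ∘L mul X =
    hmap (mul X) (ContinuousLinearMap.id ℂ (Ell2 X)) ∘L
      ((hassoc (Ell2 X) (Ell2 X) (Ell2 X)).symm : _ →L[ℂ] _) ∘L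
        hmap (ContinuousLinearMap.id ℂ (Ell2 X)) (ContinuousLinearMap.adjoint (mul X)) := by
  refine htensor_ext fun v w => ?_
  refine DFunLike.congr_fun (f := (ContinuousLinearMap.adjoint (mul X) ∘L mul X) ∘L htmulL v)
    (g := (hmap (mul X) (ContinuousLinearMap.id ℂ (Ell2 X)) ∘L
      ((hassoc (Ell2 X) (Ell2 X) (Ell2 X)).symm : _ →L[ℂ] _) ∘L
        hmap (ContinuousLinearMap.id ℂ (Ell2 X)) (ContinuousLinearMap.adjoint (mul X))) ∘L
          htmulL v) (clm_ext fun x => ?_) w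
  simp [htmulL_apply, pmul_single, adjoint_mul_single, htmul_smul, smul_htmul, smul_smul,
    mul_comm]

theorem frobenius_right (X : WPSet.{u}) : ContinuousLinearMap.adjoint (mul X) ∘L mul X =
    hmap (ContinuousLinearMap.id ℂ (Ell2 X)) (mul X) ∘L
      (hassoc (Ell2 X) (Ell2 X) (Ell2 X) : _ →L[ℂ] _) ∘L
        hmap (ContinuousLinearMap.adjoint (mul X)) (ContinuousLinearMap.id ℂ (Ell2 X)) := by
  refine htensor_ext fun v w => ?_
  refine DFunLike.congr_fun (f := (ContinuousLinearMap.adjoint (mul X) ∘L mul X) ∘L htmulL.flip w)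
    (g := (hmap (ContinuousLinearMap.id ℂ (Ell2 X)) (mul X) ∘L
      (hassoc (Ell2 X) (Ell2 X) (Ell2 X) : _ →L[ℂ] _) ∘L
        hmap (ContinuousLinearMap.adjoint (mul X)) (ContinuousLinearMap.id ℂ (Ell2 X))) ∘L
          htmulL.flip w) (clm_ext fun x => ?_) v
  simp [htmulL_apply, pmul_single, pmul_comm (single x), adjoint_mul_single, htmul_smul,
    smul_htmul, smul_smul, mul_comm]

/-- The commutative Hilbertian algebra `ℓ²_•(X)`. -/
def alg (X : WPSet.{u}) : HilbAlg.{u} where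
  carrier := Ell2 X
  mul := mul X
  assoc := htensor_ext₃ fun v w z => by ext x; simp [mul_assoc]
  comm := htensor_ext fun v w => by ext x; simp [mul_comm]

theorem isFrobenius (X : WPSet.{u}) : (alg X).IsFrobenius :=
  ⟨frobenius_left X, frobenius_right X⟩

theorem isGroupLike_single (x : X.Off) :
    HilbAlg.IsGroupLike (A := alg X) ((X.weight x : ℂ)⁻¹ • single x : Ell2 X) := by
  have hx : (X.weight x : ℂ)⁻¹ ≠ 0 := inv_ne_zero (by exact_mod_cast (X.weight_pos x).ne')
  refine ⟨fun h => hx ?_, ?_⟩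
  · classical
    have h0 : ((X.weight x : ℂ)⁻¹ • single x : Ell2 X) x = 0 :=
      congrArg (fun v : Ell2 X => v x) h
    rw [smul_apply, single_apply, if_pos rfl, mul_one] at h0
    exact h0
  · change ContinuousLinearMap.adjoint (mul X) ((X.weight x : ℂ)⁻¹ • single x) =
      htmul ((X.weight x : ℂ)⁻¹ • single x) ((X.weight x : ℂ)⁻¹ • single x)
    rw [map_smul, adjoint_mul_single, htmul_smul, smul_htmul]

theorem eq_zero_of_inner_single (v : Ell2 X) (x : X.Off)
    (h : inner ℂ ((X.weight x : ℂ)⁻¹ • single x) v = 0) : v x = 0 := by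
  have e : inner ℂ ((X.weight x : ℂ)⁻¹ • single x) v =
      starRingEnd ℂ (X.weight x : ℂ)⁻¹ * inner ℂ (single x) v := inner_smul_left _ _ _
  have hx : (X.weight x : ℂ) ≠ 0 := by exact_mod_cast (X.weight_pos x).ne'
  rw [e, inner_single] at h
  simpa [hx] using h

theorem isSemisimple (X : WPSet.{u}) : (alg X).IsSemisimple := by
  refine (Submodule.eq_bot_iff _).2 fun v hv => ?_
  refine ext_off (w := 0) fun x => ?_
  have h := (Submodule.mem_orthogonal _ _).1 (isGroupLike_single x).mem_radical_orthogonal v hv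
  exact eq_zero_of_inner_single v x (inner_eq_zero_symm.1 h)

theorem exists_norm_comp_le (f : X ⟶ Y) : ∃ M : ℝ, 0 ≤ M ∧ ∀ (v : Ell2 Y) (s : Finset X.Off),
    ∑ x ∈ s, X.weight x * ‖v (WPSet.Hom.toFun f x)‖ ^ 2 ≤ M * ‖v‖ ^ 2 := by
  classical
  obtain ⟨M, hM, h⟩ := WPSet.Hom.exists_finset_bound f
  refine ⟨M, hM, fun v s => ?_⟩
  let s' : Finset X.Off := s.filter fun x => WPSet.Hom.toFun f x ≠ Y.pt
  have hs' : ∀ x ∈ s', WPSet.Hom.toFun f x ≠ Y.pt := fun x hx => (Finset.mem_filter.1 hx).2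
  let φ : s' → Y.Off := fun x => ⟨WPSet.Hom.toFun f x.1, hs' x.1 x.2⟩
  let t : Finset Y.Off := s'.attach.image φ
  calc ∑ x ∈ s, X.weight x * ‖v (WPSet.Hom.toFun f x)‖ ^ 2
      = ∑ x ∈ s', X.weight x * ‖v (WPSet.Hom.toFun f x)‖ ^ 2 := by
        refine (Finset.sum_filter_of_ne fun x _ hne => ?_).symm
        intro h0
        apply hne
        rw [h0]; simp
    _ = ∑ x ∈ s'.attach, X.weight x * ‖v (φ x)‖ ^ 2 := (Finset.sum_attach s' _).symm
    _ = ∑ y ∈ t, ∑ x ∈ s'.attach.filter (fun x => φ x = y), X.weight x * ‖v (φ x)‖ ^ 2 :=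
        (Finset.sum_fiberwise_of_maps_to (fun x hx => Finset.mem_image_of_mem _ hx) _).symm
    _ ≤ ∑ y ∈ t, M * (Y.weight y * ‖v y‖ ^ 2) := by
        refine Finset.sum_le_sum fun y _ => ?_
        have h1 : ∑ x ∈ s'.attach.filter (fun x => φ x = y), X.weight x * ‖v (φ x)‖ ^ 2 =
            (∑ x ∈ (s'.attach.filter (fun x => φ x = y)).map (Function.Embedding.subtype _),
              X.weight x) * ‖v y‖ ^ 2 := by
          rw [Finset.sum_map, Finset.sum_mul]
          refine Finset.sum_congr rfl fun x hx => ?_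
          rw [(Finset.mem_filter.1 hx).2]; rfl
        rw [h1, ← mul_assoc]
        refine mul_le_mul_of_nonneg_right (h y _ fun x hx => ?_) (sq_nonneg _)
        obtain ⟨z, hz, rfl⟩ := Finset.mem_map.1 hx
        have hzy : φ z = y := (Finset.mem_filter.1 hz).2
        exact congrArg Subtype.val hzy
    _ = M * ∑ y ∈ t, Y.weight y * ‖v y‖ ^ 2 := by rw [Finset.mul_sum]
    _ ≤ M * ‖v‖ ^ 2 := mul_le_mul_of_nonneg_left (sum_le_hasSum t
        (fun y _ => mul_nonneg (Y.weight_pos y).le (sq_nonneg _)) (hasSum_norm_sq v)) hM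

/-- Precomposition `v ↦ v ∘ f` as a linear map. -/
def compLin (f : X ⟶ Y) : Ell2 Y →ₗ[ℂ] Ell2 X where
  toFun v := ⟨fun x => v (WPSet.Hom.toFun f x), (congrArg v.1 (WPSet.Hom.map_pt f)).trans v.pt_eq, by
    obtain ⟨M, -, h⟩ := exists_norm_comp_le f
    exact summable_of_sum_le (fun x => mul_nonneg (X.weight_pos x).le (sq_nonneg _)) (h v)⟩
  map_add' v w := rfl
  map_smul' c v := rfl

/-- Precomposition `v ↦ v ∘ f` as a bounded linear map. -/
def compCLM (f : X ⟶ Y) : Ell2 Y →L[ℂ] Ell2 X :=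
  (compLin f).mkContinuousOfExistsBound (by
    obtain ⟨M, hM, h⟩ := exists_norm_comp_le f
    refine ⟨Real.sqrt M, fun v => (sq_le_sq₀ (norm_nonneg _) (by positivity)).1 ?_⟩
    rw [mul_pow, Real.sq_sqrt hM]
    exact norm_sq_le (h v))

@[simp] theorem compCLM_apply (f : X ⟶ Y) (v : Ell2 Y) (x : X.carrier) :
    compCLM f v x = v (WPSet.Hom.toFun f x) := rfl

/-- The morphism of semigroups `v ↦ v ∘ f`. -/
def map (f : X ⟶ Y) : alg Y ⟶ alg X where
  toCLM := compCLM f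
  map_mul := htensor_ext (H := Ell2 Y) (K := Ell2 Y) (E := Ell2 X)
    (f := compCLM f ∘L mul Y) (g := mul X ∘L hmap (compCLM f) (compCLM f))
    fun v w => by ext x; simp

end Ell2

/-- The functor `ℓ²_•`. -/
def ell2Functor : WPSet.{u}ᵒᵖ ⥤ FrobSem.{u} where
  obj X := ⟨Ell2.alg X.unop, Ell2.isFrobenius X.unop⟩
  map f := ObjectProperty.homMk (Ell2.map f.unop)
  map_id _ := rfl
  map_comp _ _ := rfl

/-- The functor `ℓ²_•`, with values in the semisimple Hilbertian Frobenius semigroups. -/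
def ell2SemisimpleFunctor : WPSet.{u}ᵒᵖ ⥤ SemisimpleFrobSem.{u} :=
  ObjectProperty.lift _ ell2Functor fun X => Ell2.isSemisimple X.unop

/-- The restriction of `Min_•` to the semisimple Hilbertian Frobenius semigroups. -/
def minSemisimpleFunctor : SemisimpleFrobSem.{u} ⥤ WPSet.{u}ᵒᵖ :=
  ObjectProperty.ι _ ⋙ minFunctor

end

end HilbFrob

/-! By Riesz, a bounded linear functional on $H$ is $\langle g,\cdot\rangle$ for one vector $g$, and
it is a non-zero character exactly when $g$ is group-like. So the group-like elements are the
Gelfand spectrum, placed inside $H$ itself.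

Two facts make this spectrum control $H$. First, every maximal modular ideal is closed and, by
Gelfand–Mazur, contains (hence equals) $g^\perp$ for some group-like $g$
(`IsMaximalModular.exists_groupLike`). Hence in a semisimple object only $0$ is orthogonal to all
group-like elements (`IsSemisimple.eq_zero`). Second, the Frobenius condition makes distinct
group-like elements orthogonal, so the normalised generators of the minimal ideals are an
orthonormal family (`orthonormal_gen`).

The unit is the Gelfand transform $\Gamma v=(I\mapsto\langle g_I,v\rangle)$. The weight
$\|g_I\|^{-2}$ turns the bound $\|\Gamma v\|\le\|v\|$ into Bessel's inequality. One always has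
$\Gamma\Gamma^\dagger=\mathrm{id}$ (`gelfandCLM_comp_adjoint`), and $\Gamma$ is injective when $H$
is semisimple, so there it is unitary.

For the counit, the group-like elements of $\ell^2_\bullet(X)$ are the vectors
$e_x=\alpha(x)^{-1}\delta_x$ that represent the evaluations, and $\|e_x\|^{-2}=\alpha(x)$. Hence $X$
is isomorphic to the weighted set of minimal ideals of $\ell^2_\bullet(X)$, for every $X$
(`Ell2.pointIso`). Naturality and the triangle identities reduce to $\langle f^\dagger
g,v\rangle=\langle g,fv\rangle$.

In finite dimensions the set of minimal ideals is finite, and every pointed map out of a finite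
weighted set is a morphism. The weights can therefore be forgotten without losing the equivalence.
-/

namespace HilbFrob

noncomputable section

/-! ### Maximal modular ideals and Gelfand–Mazur. -/

namespace HilbAlg

variable {A : HilbAlg.{u}}

theorem norm_mulOp_le (y : A) : ‖A.mulOp y‖ ≤ ‖A.mul‖ * ‖y‖ :=
  ContinuousLinearMap.opNorm_le_bound _ (by positivity) fun x => by
    rw [mul_assoc]; exact norm_prod_le y x

/-- Small elements are quasi-invertible. -/
theorem exists_sub_prod_eq {y : A} (hy : ‖A.mulOp y‖ < 1) : ∃ u, u - A.prod y u = y := by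
  -- Neumann series: with $L_y$ the multiplication by $y$, take $u=(1-L_y)^{-1}y$.
  obtain ⟨w, hw⟩ := (isUnit_one_sub_of_norm_lt_one hy).exists_right_inv
  exact ⟨w y, congrArg (fun φ => φ y) hw⟩

theorem IsIdeal.topologicalClosure {I : Submodule ℂ A} (hI : IsIdeal I) :
    IsIdeal I.topologicalClosure := fun x _ hy =>
  map_mem_closure (A.mulOp x).continuous hy fun z hz => hI x z hz

/-- A modular unit of a proper ideal is not in the closure of the ideal. -/
theorem IsIdeal.notMem_topologicalClosure {I : Submodule ℂ A} (hI : IsIdeal I) (hne : I ≠ ⊤)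
    {e : A} (he : ∀ x, x - A.prod e x ∈ I) : e ∉ I.topologicalClosure := by
  intro hcl
  -- The radius forces $\|\mu\|\,\|e-m\|<1$, so that $e-m$ is quasi-invertible. The $+1$ covers
  -- $\mu=0$.
  obtain ⟨m, hm, hd⟩ := Metric.mem_closure_iff.1 hcl (1 / (‖A.mul‖ + 1)) (by positivity)
  rw [dist_eq_norm, lt_div_iff₀ (by positivity)] at hd
  have hlt : ‖A.mulOp (e - m)‖ < 1 := by
    refine (norm_mulOp_le _).trans_lt (lt_of_le_of_lt ?_ hd)
    nlinarith [norm_nonneg (e - m)]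
  obtain ⟨u, hu⟩ := exists_sub_prod_eq hlt
  have heI : e ∈ I := by
    -- This is $u-(e-m)u=e-m$ rearranged. The first summand lies in $I$ by modularity, the others
    -- because $m\in I$.
    have h1 : e = (u - A.prod e u) + A.prod u m + m := by
      rw [sub_prod, prod_comm m] at hu
      rw [← sub_eq_iff_eq_add, ← hu]; abel
    rw [h1]
    exact I.add_mem (I.add_mem (he u) (hI _ _ hm)) hm
  refine hne (eq_top_iff.2 fun y _ => ?_)
  have : A.prod e y ∈ I := by rw [prod_comm]; exact hI _ _ heI
  simpa using I.add_mem (he y) this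

/-- The closure is an ideal, and it is proper because it misses the modular unit. Maximality then
leaves no room between $M$ and its closure. -/
theorem IsMaximalModular.isClosed {M : Submodule ℂ A} (hM : IsMaximalModular M) :
    IsClosed (M : Set A) := by
  obtain ⟨⟨e, he⟩, ⟨hid, hne⟩, hmax⟩ := hM
  have h : M.topologicalClosure ≤ M := hmax ⟨hid.topologicalClosure, fun h =>
    hid.notMem_topologicalClosure hne he (h ▸ Submodule.mem_top)⟩ M.le_topologicalClosure
  rw [← M.le_topologicalClosure.antisymm' h]
  exact M.isClosed_topologicalClosure

/-- Elements outside a maximal modular ideal are invertible modulo the ideal. -/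
theorem IsMaximalModular.exists_prod_sub_mem {M : Submodule ℂ A} (hM : IsMaximalModular M)
    {e : A} (he : ∀ x, x - A.prod e x ∈ M) {x : A} (hx : x ∉ M) :
    ∃ w, A.prod x w - e ∈ M := by
  obtain ⟨-, ⟨hid, -⟩, hmax⟩ := hM
  -- Although $H$ need not have a unit, $M+xH$ contains $x$, since $x=(x-ex)+xe$.
  let K : Submodule ℂ A := M ⊔ LinearMap.range (A.mulOp x).toLinearMap
  have hmem : ∀ z, z ∈ K ↔ ∃ m ∈ M, ∃ b : A, m + A.prod x b = z := by
    intro z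
    simp only [K, Submodule.mem_sup, LinearMap.mem_range]
    constructor
    · rintro ⟨m, hm, _, ⟨b, rfl⟩, rfl⟩
      exact ⟨m, hm, b, rfl⟩
    · rintro ⟨m, hm, b, rfl⟩
      exact ⟨m, hm, _, ⟨b, rfl⟩, rfl⟩
  have hK : K = ⊤ := by
    by_contra hne
    refine hx (hmax ⟨fun a z hz => ?_, hne⟩ le_sup_left
      ((hmem x).2 ⟨_, he x, e, by rw [prod_comm x, sub_add_cancel]⟩))
    obtain ⟨m, hm, b, rfl⟩ := (hmem z).1 hz
    refine (hmem _).2 ⟨_, hid a m hm, A.prod a b, ?_⟩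
    rw [prod_add, ← prod_assoc, ← prod_assoc, prod_comm x a]
  obtain ⟨m, hm, w, hw⟩ := (hmem e).1 (hK ▸ Submodule.mem_top)
  refine ⟨w, ?_⟩
  rw [← hw, sub_add_cancel_right]
  exact M.neg_mem hm

/-- The Gelfand–Mazur theorem: modulo a maximal modular ideal, every element is a multiple of the
modular unit. -/
theorem IsMaximalModular.exists_smul_sub_mem {M : Submodule ℂ A} (hM : IsMaximalModular M)
    {e : A} (he : ∀ x, x - A.prod e x ∈ M) (z : A) : ∃ c : ℂ, c • e - z ∈ M := by
  have hid : IsIdeal M := hM.2.1.1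
  have : CompleteSpace M := hM.isClosed.completeSpace_coe
  -- $M$ is closed, so $M^\perp$ with the projection $P$ is a model of the quotient $H/M$ that is
  -- again a Hilbert space.
  let P : A →L[ℂ] Mᗮ := Mᗮ.orthogonalProjectionOnto
  have hP : ∀ x : A, x - (P x : A) ∈ M := fun x => by
    have h1 : x - (P x : A) ∈ Mᗮᗮ := Mᗮ.sub_starProjection_mem_orthogonal x
    rwa [Submodule.orthogonal_orthogonal] at h1
  have hP0 : ∀ x ∈ M, P x = 0 := fun x hx =>
    Mᗮ.orthogonalProjectionOnto_eq_zero_iff.2 (M.le_orthogonal_orthogonal hx)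
  have hPc : ∀ x y : A, x - y ∈ M → P x = P y := fun x y h => by
    rw [← sub_eq_zero, ← map_sub, hP0 _ h]
  have hPi : ∀ t : Mᗮ, P t = t := fun t => Mᗮ.orthogonalProjectionOnto_mem_subspace_eq_self t
  -- `R x` is the multiplication by $x$ on $H/M$. It is multiplicative in $x$ because $M$ is an
  -- ideal, and every element congruent to $e$ acts as the identity.
  let R : A → (Mᗮ →L[ℂ] Mᗮ) := fun x => P ∘L A.mulOp x ∘L Mᗮ.subtypeL
  have hR : ∀ x (t : Mᗮ), R x t = P (A.prod x t) := fun _ _ => rfl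
  have hRe : ∀ y, y - e ∈ M → R y = 1 := fun y hy => by
    ext1 t
    rw [hR, one_apply_eq_self]
    conv_rhs => rw [← hPi t]
    refine hPc _ _ ?_
    have h1 : A.prod y t - (t : A) = A.prod t (y - e) - (t - A.prod e t) := by
      rw [prod_sub, prod_comm (t : A), prod_comm (t : A)]; abel
    rw [h1]
    exact M.sub_mem (hid _ _ hy) (he t)
  have hRm : ∀ x y, R x * R y = R (A.prod x y) := fun x y => by
    ext1 t
    rw [mul_apply_eq_comp, hR, hR, hR]
    refine (hPc _ _ ?_).symm
    rw [prod_assoc, ← prod_sub]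
    exact hid _ _ (hP _)
  -- The spectrum is non-empty only over a non-zero space. The class of $e$ shows that $H/M\neq0$.
  have hPe : P e ≠ 0 := fun h0 => by
    have heM : e ∈ M := by simpa [h0] using hP e
    exact hid.notMem_topologicalClosure hM.2.1.2 he (M.le_topologicalClosure heM)
  have : Nontrivial Mᗮ := ⟨⟨_, _, hPe⟩⟩
  -- Take $c$ in the spectrum of `R z`. If $ce-z\notin M$, it has an inverse $w$ modulo $M$, and `R
  -- w` then inverts $c-R_z$, a contradiction.
  obtain ⟨c, hc⟩ := spectrum.nonempty (R z)
  refine ⟨c, ?_⟩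
  by_contra hne
  obtain ⟨w, hw⟩ := hM.exists_prod_sub_mem he hne
  apply hc
  have e1 : algebraMap ℂ (Mᗮ →L[ℂ] Mᗮ) c - R z = R (c • e - z) := by
    have h1 : R (c • e - z) = c • R e - R z := by
      ext1 t
      simp only [hR, sub_prod, smul_prod, map_sub, map_smul, sub_apply,
        smul_apply]
    rw [h1, hRe e (by simp), Algebra.algebraMap_eq_smul_one]
  rw [spectrum.mem_resolventSet_iff, e1]
  exact ⟨⟨R (c • e - z), R w, by rw [hRm, hRe _ hw], by rw [hRm, prod_comm, hRe _ hw]⟩, rfl⟩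

/-- A maximal modular ideal is the orthogonal complement of a group-like element. -/
theorem IsMaximalModular.exists_groupLike {M : Submodule ℂ A} (hM : IsMaximalModular M) :
    ∃ g : A, IsGroupLike g ∧ ∀ x, inner ℂ g x = 0 → x ∈ M := by
  obtain ⟨e, he⟩ := hM.1
  have hid : IsIdeal M := hM.2.1.1
  have : CompleteSpace M := hM.isClosed.completeSpace_coe
  have heM : e ∉ M := fun h =>
    hid.notMem_topologicalClosure hM.2.1.2 he (M.le_topologicalClosure h)
  obtain ⟨m, hm, p, hp, hep⟩ := M.exists_add_mem_mem_orthogonal e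
  have hp0 : (inner ℂ p p : ℂ) ≠ 0 := inner_self_ne_zero.2 fun h => heM (by simpa [hep, h] using hm)
  have hpM : ∀ y ∈ M, inner ℂ p y = 0 := fun y hy => Submodule.inner_left_of_mem_orthogonal hy hp
  -- Here $p$ is the component of $e$ orthogonal to $M$, scaled so that $\langle g,e\rangle=1$. With
  -- this scaling, $\langle g,x\rangle$ is the scalar $c$ with $x\equiv ce$ modulo $M$.
  let g : A := (inner ℂ p p : ℂ)⁻¹ • p
  have hgM : ∀ y ∈ M, inner ℂ g y = 0 := fun y hy => by
    simp only [g, inner_smul_left, hpM y hy, mul_zero]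
  have hge : inner ℂ g e = 1 := by
    simp only [g, hep, inner_smul_left, inner_add_right, hpM m hm, mul_zero, zero_add, map_inv₀,
      inner_self_conj]
    exact inv_mul_cancel₀ hp0
  have hgx : ∀ x, (inner ℂ g x : ℂ) • e - x ∈ M := fun x => by
    obtain ⟨c, hc⟩ := hM.exists_smul_sub_mem he x
    have h1 := hgM _ hc
    rw [inner_sub_right, inner_smul_right, hge, mul_one, sub_eq_zero] at h1
    rwa [← h1]
  refine ⟨g, ⟨fun h => ?_, htensor_ext_inner fun x y => ?_⟩, fun x hx => ?_⟩
  · rw [h, inner_zero_left] at hge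
    exact zero_ne_one hge
  · rw [inner_comul, inner_htmul]
    -- Modulo $M$ one has $xy\equiv\langle g,x\rangle\,ey\equiv\langle g,x\rangle\,y$. Pairing with
    -- $g$ gives multiplicativity.
    have h1 := hgM _ (hid y _ (hgx x))
    rw [prod_sub, prod_smul, inner_sub_right, inner_smul_right, sub_eq_zero, prod_comm y x,
      prod_comm y e] at h1
    have h2 := hgM _ (he y)
    rw [inner_sub_right, sub_eq_zero] at h2
    rw [← h1, ← h2]
  · have := hgx x
    rw [hx, zero_smul, zero_sub] at this
    simpa using M.neg_mem this

/-- In a semisimple algebra the group-like elements are total. -/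
theorem IsSemisimple.eq_zero (h : A.IsSemisimple) {v : A}
    (hv : ∀ g, IsGroupLike g → inner ℂ g v = 0) : v = 0 := by
  refine (Submodule.mem_bot ℂ).1 (h ▸ Submodule.mem_sInf.2 fun M hM => ?_)
  obtain ⟨g, hg, hgM⟩ := IsMaximalModular.exists_groupLike hM
  exact hgM v (hv g hg)

end HilbAlg

/-! ### Criteria for morphisms and isomorphisms of weighted pointed sets. -/

namespace WPSet

variable {X Y : WPSet.{u}}

/-- An injective base-point preserving map that preserves the weights. -/
def Hom.ofInjective (f : X.carrier → Y.carrier) (hi : Function.Injective f) (hf : f X.pt = Y.pt)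
    (hw : ∀ (x : X.Off) (y : Y.Off), f x = y → X.weight x = Y.weight y) : X ⟶ Y :=
  Hom.ofFinset f hf ⟨1, zero_le_one, fun y s hs => by
    rcases s.eq_empty_or_nonempty with rfl | ⟨x, hx⟩
    · simpa using (Y.weight_pos y).le
    · have h : s = {x} := Finset.eq_singleton_iff_unique_mem.2
        ⟨hx, fun z hz => Subtype.ext (hi ((hs z hz).trans (hs x hx).symm))⟩
      rw [h, Finset.sum_singleton, one_mul, hw x y (hs x hx)]⟩

/-- A base-point and weight preserving bijection is an isomorphism. -/
def isoOfEquiv (e : X.carrier ≃ Y.carrier) (he : e X.pt = Y.pt)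
    (hw : ∀ (x : X.Off) (y : Y.Off), e x = y → X.weight x = Y.weight y) : X ≅ Y where
  hom := Hom.ofInjective e e.injective he hw
  inv := Hom.ofInjective e.symm e.symm.injective (e.symm_apply_eq.2 he.symm)
    fun y x h => (hw x y (e.symm_apply_eq.1 h).symm).symm
  hom_inv_id := hom_ext e.symm_apply_apply
  inv_hom_id := hom_ext e.apply_symm_apply

/-- Every base-point preserving map from a finite weighted pointed set is a morphism. -/
def Hom.ofFinite [Finite X.carrier] (f : X.carrier → Y.carrier) (hf : f X.pt = Y.pt) : X ⟶ Y :=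
  Hom.ofFinset f hf (by
    have := Fintype.ofFinite X.Off
    obtain ⟨C, hC, hY⟩ := Y.exists_le
    have h0 : 0 ≤ ∑ x, X.weight x := Finset.sum_nonneg fun x _ => (X.weight_pos x).le
    -- A fibre weighs at most the total weight of $X$, and $C$ bounds the weights of $Y$ from below.
    -- So total weight over $C$ works for all $y$ at once.
    refine ⟨(∑ x, X.weight x) / C, by positivity, fun y s _ => ?_⟩
    calc ∑ x ∈ s, X.weight x ≤ ∑ x, X.weight x :=
          Finset.sum_le_sum_of_subset_of_nonneg s.subset_univ fun x _ _ => (X.weight_pos x).le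
      _ = (∑ x, X.weight x) / C * C := by field_simp
      _ ≤ (∑ x, X.weight x) / C * Y.weight y :=
          mul_le_mul_of_nonneg_left (hY y) (by positivity))

end WPSet

/-! ### The unit -/

open HilbAlg

theorem eq_of_gen_eq {A : FrobSem.{u}} {I J : A.obj.MinIdeal} (h : gen I.1 = gen J.1) : I = J :=
  Subtype.ext (by rw [← I.span_gen A.property, ← J.span_gen A.property, h])

/-- The Frobenius condition enters here, through the orthogonality of distinct group-like elements.
The family yields the bound on the Gelfand transform and, in finite dimensions, the finiteness of
the set of minimal ideals. -/
theorem orthonormal_gen (A : FrobSem.{u}) : Orthonormal ℂ fun I : (minObj A).Off =>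
    ((‖gen I.1.1‖ : ℝ) : ℂ)⁻¹ • gen I.1.1 := by
  refine ⟨fun I => ?_, fun I J hIJ => ?_⟩
  · have h0 : ‖gen I.1.1‖ ≠ 0 := norm_ne_zero_iff.2 (minObj_isGroupLike A I).1
    simp only [norm_smul, norm_inv, Complex.norm_real, norm_norm]
    exact inv_mul_cancel₀ h0
  · simp only [inner_smul_left, inner_smul_right]
    rw [(minObj_isGroupLike A I).inner_eq_zero A.property (minObj_isGroupLike A J)
      fun h => hIJ (Subtype.ext (eq_of_gen_eq h)), mul_zero, mul_zero]

/-- Bessel's inequality: the weight $\|g_I\|^{-2}$ is the factor that normalises $g_I$. -/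
theorem sum_weight_inner_gen_le (A : FrobSem.{u}) (v : A.obj) (s : Finset (minObj A).Off) :
    ∑ I ∈ s, (minObj A).weight I * ‖(inner ℂ (gen I.1.1) v : ℂ)‖ ^ 2 ≤ ‖v‖ ^ 2 := by
  refine le_of_eq_of_le (Finset.sum_congr rfl fun I _ => ?_)
    ((orthonormal_gen A).sum_inner_products_le (s := s) v)
  simp only [inner_smul_left, norm_mul, map_inv₀, Complex.conj_ofReal, norm_inv,
    Complex.norm_real, norm_norm, mul_pow, inv_pow, minObj, one_div]

/-- The map `v ↦ (I ↦ ⟪g_I, v⟫)` as a linear map. -/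
def gelfandLin (A : FrobSem.{u}) : A.obj →ₗ[ℂ] Ell2 (minObj A) where
  toFun v := ⟨fun I => inner ℂ (gen I.1) v,
    -- The base point is the zero ideal, whose generator is $0$ by convention, so the transform
    -- vanishes there.
    (congrArg (fun g : A.obj => (inner ℂ g v : ℂ)) gen_bot).trans (inner_zero_left v),
    summable_of_sum_le (fun I => mul_nonneg ((minObj A).weight_pos I).le (sq_nonneg _))
      (sum_weight_inner_gen_le A v)⟩
  map_add' v w := Ell2.ext fun _ => inner_add_right _ v w
  map_smul' c v := Ell2.ext fun _ => inner_smul_right _ v c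

/-- The map `v ↦ (I ↦ ⟪g_I, v⟫)` as a contraction. -/
def gelfandCLM (A : FrobSem.{u}) : A.obj →L[ℂ] Ell2 (minObj A) :=
  (gelfandLin A).mkContinuous 1 fun v => by
    rw [one_mul]
    exact (sq_le_sq₀ (norm_nonneg _) (norm_nonneg _)).1
      (Ell2.norm_sq_le (sum_weight_inner_gen_le A v))

theorem gelfandCLM_apply (A : FrobSem.{u}) (v : A.obj) (I : A.obj.MinIdeal) :
    gelfandCLM A v I = inner ℂ (gen I.1) v := rfl

theorem inner_gen_prod (A : FrobSem.{u}) (I : A.obj.MinIdeal) (v w : A.obj) :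
    (inner ℂ (gen I.1) (A.obj.prod v w) : ℂ) = inner ℂ (gen I.1) v * inner ℂ (gen I.1) w := by
  rcases I.gen_eq_zero_or A.property with h | h
  · simp only [h, inner_zero_left, mul_zero]
  · exact h.inner_prod v w

/-- The Gelfand transform, the unit of the adjunction. -/
def gelfand (A : FrobSem.{u}) : A ⟶ ell2Functor.obj (Opposite.op (minObj A)) :=
  ObjectProperty.homMk (Hom.ofProd (B := Ell2.alg (minObj A)) (gelfandCLM A) fun v w => by
    refine Eq.trans ?_ (Ell2.mul_htmul (gelfandCLM A v) (gelfandCLM A w)).symm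
    exact Ell2.ext fun I => inner_gen_prod A I v w)

/-! ### The counit -/

namespace Ell2

variable {X Y : WPSet.{u}}

open Classical in
/-- The vector that represents the evaluation at a point. -/
def evalVec (x : X.carrier) : Ell2 X :=
  if h : x = X.pt then 0 else (X.weight ⟨x, h⟩ : ℂ)⁻¹ • single ⟨x, h⟩

theorem evalVec_pt : evalVec X.pt = 0 := dif_pos rfl

theorem evalVec_off (x : X.Off) : evalVec (x : X.carrier) = (X.weight x : ℂ)⁻¹ • single x :=
  dif_neg x.2

theorem weight_ne_zero (x : X.Off) : (X.weight x : ℂ) ≠ 0 := by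
  exact_mod_cast (X.weight_pos x).ne'

theorem inner_evalVec (x : X.carrier) (v : Ell2 X) : inner ℂ (evalVec x) v = v x := by
  by_cases h : x = X.pt
  · rw [h, evalVec_pt, inner_zero_left, pt_eq]
  · lift x to X.Off using h
    rw [evalVec_off, inner_smul_left, inner_single, map_inv₀, Complex.conj_ofReal,
      inv_mul_cancel_left₀ (weight_ne_zero x)]

/-- Links the indicator functions, which determine bounded maps (`clm_ext`), with the evaluation
vectors, for which adjoints are easy to compute. -/
theorem single_eq (x : X.Off) : single x = (X.weight x : ℂ) • evalVec (x : X.carrier) := by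
  rw [evalVec_off, smul_smul, mul_inv_cancel₀ (weight_ne_zero x), one_smul]

theorem evalVec_self (x : X.Off) : evalVec (x : X.carrier) x = (X.weight x : ℂ)⁻¹ := by
  rw [evalVec_off, smul_apply, single_apply, if_pos rfl, mul_one]

theorem evalVec_of_ne {x y : X.carrier} (h : y ≠ x) : evalVec x y = 0 := by
  by_cases hx : x = X.pt
  · rw [hx, evalVec_pt, zero_apply]
  · lift x to X.Off using hx
    rw [evalVec_off, smul_apply, single_apply, if_neg h, mul_zero]

/-- Reproducing property: $\|e_x\|^2=\langle e_x,e_x\rangle=e_x(x)=\alpha(x)^{-1}$. This is why the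
counit preserves weights. -/
theorem norm_evalVec_sq (x : X.Off) : 1 / ‖evalVec (x : X.carrier)‖ ^ 2 = X.weight x := by
  have h1 : ((‖evalVec (x : X.carrier)‖ ^ 2 : ℝ) : ℂ) = ((X.weight x)⁻¹ : ℝ) := by
    have h2 := inner_self_eq_norm_sq_to_K (𝕜 := ℂ) (evalVec (x : X.carrier))
    rw [inner_evalVec, evalVec_self] at h2
    push_cast
    exact h2.symm
  rw [Complex.ofReal_inj.1 h1, one_div, inv_inv]

theorem evalVec_injective : Function.Injective (evalVec (X := X)) := by
  intro x y h
  by_contra hne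
  -- At most one of two distinct points is the base point, so it is enough to separate the vectors
  -- by evaluating at one that is not.
  have key : ∀ (x : X.Off) (y : X.carrier), y ≠ x → evalVec (x : X.carrier) ≠ evalVec y := by
    intro x y hne h
    have h1 := congrArg (fun v : Ell2 X => v x) h
    simp only [evalVec_self, evalVec_of_ne hne.symm] at h1
    exact inv_ne_zero (weight_ne_zero x) h1
  by_cases hx : x = X.pt
  · have hy : y ≠ X.pt := fun hy => hne (hx.trans hy.symm)
    exact key ⟨y, hy⟩ x hne h.symm
  · exact key ⟨x, hx⟩ y (Ne.symm hne) h

theorem evalVec_eq_zero_or (x : X.carrier) :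
    (evalVec x : alg X) = 0 ∨ IsGroupLike (A := alg X) (evalVec x) := by
  by_cases h : x = X.pt
  · left; rw [h]; exact evalVec_pt
  · right
    lift x to X.Off using h
    rw [evalVec_off]
    exact isGroupLike_single x

/-- A group-like $g$ that differs from every $e_x$ is orthogonal to all of them. Then $g(x)=\langle
e_x,g\rangle=0$ for all $x$, contrary to $g\ne0$. -/
theorem eq_evalVec_of_isGroupLike {g : alg X} (hg : IsGroupLike g) :
    ∃ x : X.Off, evalVec (x : X.carrier) = g := by
  by_contra! hne
  refine hg.1 (ext_off (w := 0) fun x => ?_)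
  have hx : IsGroupLike (A := alg X) (evalVec (x : X.carrier)) := by
    rw [evalVec_off]
    exact isGroupLike_single x
  have h := hx.inner_eq_zero (isFrobenius X) hg (hne x)
  exact (inner_evalVec x.1 (g : Ell2 X)).symm.trans h

/-- $\langle e_x,v\circ f\rangle=v(f(x))=\langle e_{f(x)},v\rangle$. Naturality of the counit rests
on this. -/
theorem adjoint_compCLM_evalVec (f : X ⟶ Y) (x : X.carrier) :
    ContinuousLinearMap.adjoint (compCLM f) (evalVec x) = evalVec (WPSet.Hom.toFun f x) :=
  ext_inner_right ℂ fun v => by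
    rw [ContinuousLinearMap.adjoint_inner_left, inner_evalVec, inner_evalVec, compCLM_apply]

/-- The minimal ideal of `ℓ²_•(X)` at a point of `X`. -/
def pointIdeal (x : X.carrier) : (alg X).MinIdeal :=
  lineOf (isFrobenius X) (evalVec x) (evalVec_eq_zero_or x)

theorem gen_pointIdeal (x : X.carrier) : gen (pointIdeal x).1 = evalVec x :=
  gen_lineOf (isFrobenius X) (evalVec x : alg X) (evalVec_eq_zero_or x)

theorem pointIdeal_pt : (pointIdeal X.pt).1 = ⊥ := by
  change (ℂ ∙ (evalVec X.pt : alg X)) = ⊥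
  exact Submodule.span_singleton_eq_bot.2 evalVec_pt

/-- Ideals of this kind are determined by their generators, and the generators are exactly the
evaluation vectors. The vector at the base point is $0$, which generates the zero ideal. -/
theorem pointIdeal_bijective : Function.Bijective (pointIdeal (X := X)) := by
  refine ⟨fun x y h => evalVec_injective ?_, fun I => ?_⟩
  · rw [← gen_pointIdeal, h, gen_pointIdeal]
  · rcases I.gen_eq_zero_or (isFrobenius X) with h | h
    · refine ⟨X.pt, Subtype.ext ?_⟩
      rw [pointIdeal_pt, ← I.span_gen (isFrobenius X), h, Submodule.span_zero_singleton]
    · obtain ⟨x, hx⟩ := eq_evalVec_of_isGroupLike h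
      refine ⟨x, eq_of_gen_eq (A := ⟨alg X, isFrobenius X⟩) ?_⟩
      exact (gen_pointIdeal x.1).trans hx

/-- The counit of the adjunction, an isomorphism of weighted pointed sets. -/
def pointIso (X : WPSet.{u}) : X ≅ minObj (ell2Functor.obj (Opposite.op X)) :=
  WPSet.isoOfEquiv (Equiv.ofBijective (pointIdeal (X := X)) pointIdeal_bijective)
    (Subtype.ext pointIdeal_pt) fun x I h => by
      have h1 : gen I.1.1 = evalVec x.1 := by rw [← h]; exact gen_pointIdeal x.1
      change X.weight x = 1 / ‖gen I.1.1‖ ^ 2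
      rw [h1]
      exact (norm_evalVec_sq x).symm

end Ell2

/-! ### The adjunctions -/

/-- $\langle\Gamma^\dagger e_I,v\rangle=(\Gamma v)(I)=\langle g_I,v\rangle$. Both the left triangle
identity and $\Gamma\Gamma^\dagger=\mathrm{id}$ come from this formula. -/
theorem adjoint_gelfandCLM_evalVec (A : FrobSem.{u}) (I : A.obj.MinIdeal) :
    ContinuousLinearMap.adjoint (gelfandCLM A) (Ell2.evalVec (X := minObj A) I) = gen I.1 :=
  ext_inner_right ℂ fun v => by
    rw [ContinuousLinearMap.adjoint_inner_left]
    exact Ell2.inner_evalVec (X := minObj A) I (gelfandCLM A v)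

theorem frobSem_hom_ext {A : FrobSem.{u}} {X : WPSet.{u}}
    {f g : A ⟶ ell2Functor.obj (Opposite.op X)}
    (h : ∀ (v : A.obj) (x : X.carrier), Subtype.val (p := (· ∈ ell2Submodule X))
      (Hom.toCLM f.hom v) x = Subtype.val (p := (· ∈ ell2Submodule X)) (Hom.toCLM g.hom v) x) :
    f = g :=
  ObjectProperty.hom_ext _ (Hom.ext (ContinuousLinearMap.ext fun v => Ell2.ext (h v)))

/-- The unit of the adjunction. -/
def gelfandNat : 𝟭 FrobSem.{u} ⟶ minFunctor.{u} ⋙ ell2Functor.{u} where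
  app := gelfand
  -- At $J$ the square reads $\langle g_J,fv\rangle=\langle f^\dagger g_J,v\rangle$, and $f^\dagger
  -- g_J$ is the generator of the image of $J$.
  naturality A B f := frobSem_hom_ext fun v (J : B.obj.MinIdeal) =>
    (ContinuousLinearMap.adjoint_inner_left (Hom.toCLM f.hom) v (gen J.1)).symm.trans
      (congrArg (fun g : A.obj => (inner ℂ g v : ℂ)) (gen_minMap f J).symm)

/-- The left triangle identity, read in $\mathbf{WSet}_\bullet$ rather than its opposite: $I$ goes
to the line of $\Gamma^\dagger e_I=g_I$, which is $I$. -/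
theorem minMap_gelfand (A : FrobSem.{u}) :
    (Ell2.pointIso (minObj A)).hom ≫ minMap (gelfand A) = 𝟙 (minObj A) :=
  WPSet.hom_ext fun I => eq_of_gen_eq (A := A) <| by
    refine (gen_minMap (gelfand A) (Ell2.pointIdeal (X := minObj A) I)).trans ?_
    exact (congrArg (ContinuousLinearMap.adjoint (gelfandCLM A)) (Ell2.gen_pointIdeal _)).trans
      (adjoint_gelfandCLM_evalVec A I)

/-- The right triangle identity: the transform of $v$ at the ideal of $x$ is $\langle
e_x,v\rangle=v(x)$. -/
theorem gelfand_comp_map_pointIso (X : WPSet.{u}) :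
    gelfand (ell2Functor.obj (Opposite.op X)) ≫ ell2Functor.map (Ell2.pointIso X).hom.op =
      𝟙 (ell2Functor.obj (Opposite.op X)) :=
  frobSem_hom_ext fun v x =>
    (congrArg (fun g : Ell2 X => (inner ℂ g v : ℂ)) (Ell2.gen_pointIdeal x)).trans
      (Ell2.inner_evalVec x v)

/-- The counit of the adjunction. -/
def pointNat : ell2Functor.{u} ⋙ minFunctor.{u} ⟶ 𝟭 WPSet.{u}ᵒᵖ where
  app X := (Ell2.pointIso X.unop).hom.op
  naturality X Y f := by
    refine congrArg Quiver.Hom.op (WPSet.hom_ext fun x => ?_)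
    refine eq_of_gen_eq (A := ell2Functor.obj X) ?_
    refine (gen_minMap (ell2Functor.map f) (Ell2.pointIdeal x)).trans ?_
    refine ((congrArg (ContinuousLinearMap.adjoint (Ell2.compCLM f.unop))
      (Ell2.gen_pointIdeal x)).trans (Ell2.adjoint_compCLM_evalVec f.unop x)).trans ?_
    exact (Ell2.gen_pointIdeal (WPSet.Hom.toFun f.unop x)).symm

/-- The adjunction `Min_• ⊣ ℓ²_•`. -/
def minAdjunction : minFunctor.{u} ⊣ ell2Functor.{u} where
  unit := gelfandNat
  counit := pointNat
  left_triangle_components A := congrArg Quiver.Hom.op (minMap_gelfand A)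
  right_triangle_components X := gelfand_comp_map_pointIso X.unop

/-- The adjunction `Min_• ⊣ ℓ²_•` on semisimple objects. -/
def minSemisimpleAdjunction : minSemisimpleFunctor.{u} ⊣ ell2SemisimpleFunctor.{u} where
  unit :=
    { app := fun A => ObjectProperty.homMk (gelfand A.obj)
      naturality := fun _ _ f => ObjectProperty.hom_ext _ (gelfandNat.naturality f.hom) }
  counit :=
    { app := pointNat.app
      naturality := fun _ _ f => pointNat.naturality f }
  left_triangle_components A := congrArg Quiver.Hom.op (minMap_gelfand A.obj)
  right_triangle_components X := ObjectProperty.hom_ext _ (gelfand_comp_map_pointIso X.unop)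

/-! ### The equivalences -/

/-- Since $\Gamma^\dagger e_I=g_I$, it suffices that $\Gamma g_I=e_I$. Off $I$ this is orthogonality
of group-like elements, and at $I$ it is $\|g_I\|^2=\alpha(I)^{-1}$. So $\Gamma$ is a coisometry for
every object, semisimple or not. -/
theorem gelfandCLM_comp_adjoint (A : FrobSem.{u}) :
    gelfandCLM A ∘L ContinuousLinearMap.adjoint (gelfandCLM A) =
      ContinuousLinearMap.id ℂ (Ell2 (minObj A)) := by
  refine Ell2.clm_ext fun I => ?_
  rw [Ell2.single_eq, map_smul, map_smul]
  refine congrArg (((minObj A).weight I : ℂ) • ·) ?_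
  refine (congrArg (gelfandCLM A) (adjoint_gelfandCLM_evalVec A I.1)).trans ?_
  refine Ell2.ext_off fun J => ?_
  refine (gelfandCLM_apply A (gen I.1.1) J.1).trans ?_
  change _ = Ell2.evalVec I.1 J.1
  by_cases h : J = I
  · subst h
    rw [Ell2.evalVec_self, inner_self_eq_norm_sq_to_K]
    simp [minObj]
  · rw [Ell2.evalVec_of_ne fun h' => h (Subtype.ext h')]
    exact (minObj_isGroupLike A J).inner_eq_zero A.property (minObj_isGroupLike A I)
      fun h' => h (Subtype.ext (eq_of_gen_eq h'))

theorem gelfandCLM_injective {A : FrobSem.{u}} (hA : A.obj.IsSemisimple) :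
    Function.Injective (gelfandCLM A) := by
  refine (injective_iff_map_eq_zero _).2 fun v hv => hA.eq_zero fun g hg => ?_
  -- Every group-like $g$ generates its own line, so evaluating $\Gamma v=0$ at that line gives
  -- $\langle g,v\rangle=0$.
  have h := congrArg (fun w : Ell2 (minObj A) => w (lineOf A.property g (Or.inr hg))) hv
  simp only [gelfandCLM_apply, gen_lineOf] at h
  exact h

/-- An injective map with a right inverse is invertible: $\Gamma(\Gamma^\dagger\Gamma v)=\Gamma v$.
-/
theorem adjoint_gelfandCLM_comp {A : FrobSem.{u}} (hA : A.obj.IsSemisimple) :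
    ContinuousLinearMap.adjoint (gelfandCLM A) ∘L gelfandCLM A = ContinuousLinearMap.id ℂ A.obj :=
  ContinuousLinearMap.ext fun v => gelfandCLM_injective hA
    (congrArg (fun φ => φ (gelfandCLM A v)) (gelfandCLM_comp_adjoint A))

/-- The Gelfand transform of a semisimple object is invertible. -/
theorem isIso_gelfand {A : FrobSem.{u}} (hA : A.obj.IsSemisimple) : IsIso (gelfand A) := by
  have hinv : ∀ w, gelfandCLM A (ContinuousLinearMap.adjoint (gelfandCLM A) w) = w :=
    fun w => congrArg (fun φ => φ w) (gelfandCLM_comp_adjoint A)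
  -- The inverse is $\Gamma^\dagger$. It is multiplicative because it is the inverse of an injective
  -- multiplicative map.
  refine ⟨ObjectProperty.homMk (Hom.ofProd (A := Ell2.alg (minObj A))
    (ContinuousLinearMap.adjoint (gelfandCLM A)) fun v w => ?_), ?_, ?_⟩
  · apply gelfandCLM_injective hA
    refine (hinv _).trans ?_
    refine Eq.trans ?_ ((gelfand A).hom.map_prod _ _).symm
    exact congrArg₂ (Ell2.alg (minObj A)).prod (hinv v).symm (hinv w).symm
  · exact ObjectProperty.hom_ext _ (Hom.ext (adjoint_gelfandCLM_comp hA))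
  · exact ObjectProperty.hom_ext _ (Hom.ext (gelfandCLM_comp_adjoint A))

theorem isIso_minSemisimpleAdjunction_unit : IsIso minSemisimpleAdjunction.{u}.unit := by
  have : ∀ A, IsIso (minSemisimpleAdjunction.{u}.unit.app A) := fun A => by
    have h : IsIso (gelfand A.obj) := isIso_gelfand A.property
    exact ((ObjectProperty.isoMk _ (@asIso _ _ _ _ (gelfand A.obj) h) :
      A ≅ ell2SemisimpleFunctor.obj (minSemisimpleFunctor.obj A))).isIso_hom
  exact NatIso.isIso_of_isIso_app _

theorem isIso_minSemisimpleAdjunction_counit : IsIso minSemisimpleAdjunction.{u}.counit := by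
  have : ∀ X, IsIso (minSemisimpleAdjunction.{u}.counit.app X) := fun X =>
    (Ell2.pointIso X.unop).op.isIso_hom
  exact NatIso.isIso_of_isIso_app _

/-! ### Finite-dimensional objects -/

/-- The non-zero points index an orthonormal, hence linearly independent, family; the base point
adds one more. -/
theorem finite_minObj (A : FrobSem.{u}) [FiniteDimensional ℂ A.obj] :
    Finite (minObj A).carrier := by
  have h : Finite (minObj A).Off := (orthonormal_gen A).linearIndependent.finite
  have h1 : {I | I ≠ (minObj A).pt}.Finite := h
  exact Set.finite_univ_iff.1 ((h1.union (Set.finite_singleton (minObj A).pt)).subset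
    fun I _ => (em (I = (minObj A).pt)).symm)

theorem finiteDimensional_ell2 (X : WPSet.{u}) [Finite X.carrier] :
    FiniteDimensional ℂ (Ell2 X) :=
  inferInstanceAs (FiniteDimensional ℂ (ell2Submodule X))

theorem minMap_id (A : FrobSem.{u}) : minMap (𝟙 A) = 𝟙 (minObj A) :=
  congrArg Quiver.Hom.unop (minFunctor.map_id A)

theorem minMap_comp {A B C : FrobSem.{u}} (f : A ⟶ B) (g : B ⟶ C) :
    minMap (f ≫ g) = minMap g ≫ minMap f :=
  congrArg Quiver.Hom.unop (minFunctor.map_comp f g)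

/-- The pointed set of minimal ideals of a finite-dimensional object. -/
def minFinObj (A : FdSemisimpleFrobSem.{u}) : FinPointed.{u} :=
  ⟨WPSet.forgetWeight.obj (minObj A.obj.obj), have := A.property; finite_minObj A.obj.obj⟩

/-- The action of `Min_•` on morphisms of finite-dimensional objects. -/
def minFinMap {A B : FdSemisimpleFrobSem.{u}} (f : A ⟶ B) : minFinObj B ⟶ minFinObj A :=
  ObjectProperty.homMk (WPSet.forgetWeight.map (minMap f.hom.hom))

/-- `Min_•` on the finite-dimensional semisimple objects, with values in finite pointed sets. -/
def minFinFunctor : FdSemisimpleFrobSem.{u} ⥤ FinPointed.{u}ᵒᵖ where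
  obj A := Opposite.op (minFinObj A)
  map f := (minFinMap f).op
  map_id A := congrArg Quiver.Hom.op (ObjectProperty.hom_ext _
    (congrArg (fun f => WPSet.forgetWeight.map f) (minMap_id A.obj.obj)))
  map_comp f g := congrArg Quiver.Hom.op (ObjectProperty.hom_ext _
    (congrArg (fun f => WPSet.forgetWeight.map f) (minMap_comp f.hom.hom g.hom.hom)))

/-- A left adjoint whose unit is invertible is fully faithful. -/
theorem minSemisimpleFunctor_fullyFaithful :
    minSemisimpleFunctor.{u}.Full ∧ minSemisimpleFunctor.{u}.Faithful := by
  have := isIso_minSemisimpleAdjunction_unit.{u}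
  have h := minSemisimpleAdjunction.{u}.fullyFaithfulLOfIsIsoUnit
  exact ⟨h.full, h.faithful⟩

/-- Full faithfulness is inherited from the semisimple case: a morphism of weighted sets is
determined by its underlying map, and on finite sets every pointed map is such a morphism. Essential
surjectivity uses the counit. -/
theorem minFinFunctor_isEquivalence : minFinFunctor.{u}.IsEquivalence := by
  obtain ⟨hfull, hfaith⟩ := minSemisimpleFunctor_fullyFaithful.{u}
  refine { faithful := ⟨fun {A B f g} h => ?_⟩, full := ⟨fun {A B} f => ?_⟩, essSurj := ⟨fun X => ?_⟩ }
  · refine ObjectProperty.hom_ext _ (minSemisimpleFunctor.map_injective ?_)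
    refine congrArg Quiver.Hom.op (WPSet.hom_ext fun J => ?_)
    exact congrArg (fun k => k.unop.hom.toFun J) h
  · have := B.property
    have := finite_minObj B.obj.obj
    obtain ⟨k, hk⟩ := minSemisimpleFunctor.map_surjective
      (X := A.obj) (Y := B.obj)
      (WPSet.Hom.ofFinite (X := minObj B.obj.obj) (Y := minObj A.obj.obj)
        f.unop.hom.toFun f.unop.hom.map_point).op
    exact ⟨ObjectProperty.homMk k,
      congrArg Quiver.Hom.op (ObjectProperty.hom_ext _
        (congrArg (fun f => WPSet.forgetWeight.map (Quiver.Hom.unop f)) hk))⟩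
  -- The weights are forgotten in the end, so any choice would do; the constant $1$ is the simplest.
  · let W : WPSet.{u} := ⟨X.unop.obj, X.unop.obj.point, fun _ => 1, 1, one_pos, fun _ => le_rfl⟩
    have : Finite W.carrier := X.unop.property
    let A : FdSemisimpleFrobSem.{u} :=
      ⟨ell2SemisimpleFunctor.obj (Opposite.op W), finiteDimensional_ell2 W⟩
    have i : X.unop ≅ (minFinFunctor.obj A).unop :=
      ObjectProperty.isoMk _ (WPSet.forgetWeight.mapIso (Ell2.pointIso W))
    exact ⟨A, ⟨i.op⟩⟩

end

end HilbFrob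

theorem mainTheorem5 :
    (∃ (adj : HilbFrob.minFunctor.{u} ⊣ HilbFrob.ell2Functor.{u})
      (adjS : HilbFrob.minSemisimpleFunctor.{u} ⊣ HilbFrob.ell2SemisimpleFunctor.{u}),
      (∀ A, (adjS.unit.app A).hom = adj.unit.app A.obj) ∧
      (∀ X, adjS.counit.app X = adj.counit.app X) ∧
      IsIso adjS.unit ∧ IsIso adjS.counit) ∧
    (∃ e : HilbFrob.FdSemisimpleFrobSem.{u} ≌ HilbFrob.FinPointed.{u}ᵒᵖ,
      Nonempty (e.functor ⋙ (ObjectProperty.ι fun X : Pointed.{u} => Finite X).op ≅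
        (ObjectProperty.ι fun A : HilbFrob.SemisimpleFrobSem.{u} =>
          FiniteDimensional ℂ A.obj.obj.carrier) ⋙
          HilbFrob.minSemisimpleFunctor.{u} ⋙ HilbFrob.WPSet.forgetWeight.{u}.op)) := by
  refine ⟨⟨HilbFrob.minAdjunction, HilbFrob.minSemisimpleAdjunction, fun _ => rfl, fun _ => rfl,
    HilbFrob.isIso_minSemisimpleAdjunction_unit, HilbFrob.isIso_minSemisimpleAdjunction_counit⟩, ?_⟩
  have := HilbFrob.minFinFunctor_isEquivalence.{u}
  -- The two composites coincide by definition, so the identity serves as the natural isomorphism.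
  exact ⟨HilbFrob.minFinFunctor.asEquivalence, ⟨Iso.refl _⟩⟩
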